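/- Let $T\ge 1$ and let $(a_i)_{i\ge 0}$, $(b_i)_{i\ge 0}$ be $T$-periodic real sequences with $a_i>0$ for all $i$. Let $J_T$ be the period-$T$ Jacobi operator on $\ell^2(\mathbb N;\mathbb R)$, $\mathbb N=\{1,2,3,\dots\}$, given by the infinite tridiagonal symmetric matrix with diagonal $b_1,b_2,b_3,\dots$ and off-diagonals $a_1,a_2,a_3,\dots$. Put $$B_i(\lambda)=\begin{pmatrix}0&1\\ -\frac{a_{i-1}}{a_i}&\frac{\lambda-b_i}{a_i}\end{pmatrix}\quad(1\le i\le T),\qquad M(\lambda)=B_T(\lambda)\cdots B_1(\lambda),$$ where $a_0=a_T$, and $\sigma_{ell}(J_T)=\{\lambda\in\mathbb R : |\operatorname{Tr}M(\lambda)|<2\}$. For $\lambda\in\sigma_{ell}(J_T)$ the quasi-momentum $\theta(\lambda)\in(0,\pi)$ is the number such that the eigenvalues of $M(\lambda)$ are $e^{\pm i\theta(\lambda)}$. Let $(\lambda_i)_{i\ge 1}$ be a sequence in $\sigma_{ell}(J_T)$ such that, for every $n\ge 3$, the numbers $\pi,\theta(\lambda_3),\theta(\lambda_4),\dots,\theta(\lambda_n)$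 are linearly independent over $\mathbb Q$, and such that $$0<\theta(\lambda_1)<\frac{\pi}{2}<\theta(\lambda_2)<\pi,\qquad \theta(\lambda_1)\neq\pi-\theta(\lambda_2).$$ Then for every sequence $(K(n))_{n\ge 1}$ of positive real numbers with $K(n)\to\infty$ as $n\to\infty$ (arbitrarily slowly) there is a real potential $(q_n)_{n\ge 1}$ with $q_n\to 0$ and $|q_n|\le \frac{K(n)}{n}$ for all $n\ge 1$ such that, with $Q$ the infinite diagonal matrix with entries $(q_n)$, for every $i\ge 1$ there is a non-zero vector $(u_{n,i})_{n\ge 1}\in\ell^2(\mathbb N;\mathbb R)$ with $$(J_T+Q)(u_{n,i})_{n\ge 1}=\lambda_i\,(u_{n,i})_{n\ge 1}.$$ -/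

import Mathlib

open Filter Topology

namespace PeriodicJacobi

/-- The half-infinite tridiagonal (Jacobi) matrix, with rows and columns indexed by `1, 2, 3, …`,
whose diagonal is `b₁, b₂, …` and whose two off-diagonals are `a₁, a₂, …`.
The values `a 0`, `b 0` do not enter. -/
def jacobiMatrix (a b : ℕ → ℝ) : Matrix ℕ+ ℕ+ ℝ :=
  Matrix.of fun m n =>
    if m = n then b m
    else if n = m + 1 then a m
    else if m = n + 1 then a n
    else 0

/-- The action of an infinite matrix on a sequence. For the tridiagonal matrices used here every
row has finitely many non-zero entries, so the sum is a finite one. -/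
noncomputable def act (A : Matrix ℕ+ ℕ+ ℝ) (u : ℕ+ → ℝ) : ℕ+ → ℝ :=
  fun m => ∑' n, A m n * u n

/-- The transfer matrix `B_i(l)`, for `i ≥ 1`. For `T`-periodic `a` one has `a 0 = a T`. -/
noncomputable def transferMatrix (a b : ℕ → ℝ) (l : ℝ) (i : ℕ) : Matrix (Fin 2) (Fin 2) ℝ :=
  !![0, 1; -(a (i - 1) / a i), (l - b i) / a i]

/-- The product `B_k(l) ⋯ B_1(l)`. -/
noncomputable def transferProd (a b : ℕ → ℝ) (l : ℝ) : ℕ → Matrix (Fin 2) (Fin 2) ℝ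
  | 0 => 1
  | k + 1 => transferMatrix a b l (k + 1) * transferProd a b l k

/-- The monodromy matrix `M(l) = B_T(l) ⋯ B_1(l)`. -/
noncomputable def monodromy (T : ℕ) (a b : ℕ → ℝ) (l : ℝ) : Matrix (Fin 2) (Fin 2) ℝ :=
  transferProd a b l T

/-- The generalised interior of the essential spectrum: the real `l` with `|Tr M(l)| < 2`. -/
def sigmaEll (T : ℕ) (a b : ℕ → ℝ) : Set ℝ :=
  {l | |(monodromy T a b l).trace| < 2}

/-- The quasi-momentum. For `l` in `sigmaEll` it is the unique `θ ∈ (0, π)` such that the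
eigenvalues of the monodromy matrix are `exp (iθ)` and `exp (-iθ)`; see `quasiMomentum_mem` and
`spectrum_eq_iff` below. -/
noncomputable def quasiMomentum (T : ℕ) (a b : ℕ → ℝ) (l : ℝ) : ℝ :=
  Real.arccos ((monodromy T a b l).trace / 2)

theorem quasiMomentum_mem {T : ℕ} {a b : ℕ → ℝ} {l : ℝ} (hl : l ∈ sigmaEll T a b) :
    quasiMomentum T a b l ∈ Set.Ioo 0 Real.pi := by
  have h := abs_lt.1 (show |(monodromy T a b l).trace| < 2 from hl)
  refine ⟨Real.arccos_pos.2 (by linarith), lt_of_le_of_ne (Real.arccos_le_pi _) fun h' => ?_⟩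
  have := Real.arccos_eq_pi.1 h'
  linarith

theorem det_transferProd {a : ℕ → ℝ} (b : ℕ → ℝ) (l : ℝ) (ha : ∀ i, 0 < a i) (k : ℕ) :
    (transferProd a b l k).det = a 0 / a k := by
  induction k with
  | zero => simp [transferProd, (ha 0).ne']
  | succ k ih =>
    have h1 := (ha k).ne'
    have h2 := (ha (k + 1)).ne'
    rw [transferProd, Matrix.det_mul, ih, transferMatrix, Matrix.det_fin_two_of]
    simp only [Nat.add_sub_cancel]
    field_simp
    ring

theorem det_monodromy {T : ℕ} {a : ℕ → ℝ} (b : ℕ → ℝ) (l : ℝ) (ha : ∀ i, 0 < a i)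
    (hap : Function.Periodic a T) : (monodromy T a b l).det = 1 := by
  have h : a T = a 0 := by simpa using hap 0
  rw [monodromy, det_transferProd b l ha, h, div_self (ha 0).ne']

theorem spectrum_eq_iff {T : ℕ} {a b : ℕ → ℝ} {l : ℝ} (ha : ∀ i, 0 < a i)
    (hap : Function.Periodic a T) (hl : l ∈ sigmaEll T a b) {t : ℝ} (ht : t ∈ Set.Ioo 0 Real.pi) :
    spectrum ℂ ((monodromy T a b l).map (fun x : ℝ => (x : ℂ))) =
        {Complex.exp (t * Complex.I), Complex.exp (-(t * Complex.I))} ↔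
      t = quasiMomentum T a b l := by
  have key : ∀ (s : ℝ), 2 * Real.cos s = (monodromy T a b l).trace → ∀ z : ℂ,
      z ∈ spectrum ℂ ((monodromy T a b l).map (fun x : ℝ => (x : ℂ))) ↔
        z = Complex.exp (s * Complex.I) ∨ z = Complex.exp (-(s * Complex.I)) := by
    intro s hs z
    have hdet := det_monodromy b l ha hap
    generalize monodromy T a b l = M at *
    rw [spectrum.mem_iff, Matrix.isUnit_iff_isUnit_det, isUnit_iff_ne_zero, not_not,
      Matrix.det_fin_two, Matrix.algebraMap_eq_diagonal]
    rw [Matrix.det_fin_two] at hdet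
    rw [Matrix.trace_fin_two] at hs
    have hdet' : (M 0 0 : ℂ) * M 1 1 - M 0 1 * M 1 0 = 1 := by exact_mod_cast hdet
    have hs' : 2 * Complex.cos s = M 0 0 + M 1 1 := by exact_mod_cast hs
    have hc : Complex.exp (s * Complex.I) + Complex.exp (-(s * Complex.I)) = M 0 0 + M 1 1 := by
      rw [← hs', Complex.two_cos, neg_mul]
    have hp : Complex.exp (s * Complex.I) * Complex.exp (-(s * Complex.I)) = 1 := by
      rw [← Complex.exp_add, add_neg_cancel, Complex.exp_zero]
    rw [← sub_eq_zero (a := z), ← sub_eq_zero (a := z) (b := Complex.exp (-(s * Complex.I))),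
      ← mul_eq_zero]
    simp [-mul_eq_zero]
    constructor
    · intro h
      linear_combination h - z * hc + hp - hdet'
    · intro h
      linear_combination h + z * hc - hp + hdet'
  have htr := abs_lt.1 (show |(monodromy T a b l).trace| < 2 from hl)
  have hq : 2 * Real.cos (quasiMomentum T a b l) = (monodromy T a b l).trace := by
    rw [quasiMomentum, Real.cos_arccos (by linarith) (by linarith)]
    ring
  constructor
  · intro h
    have hmem : Complex.exp (t * Complex.I) ∈
        spectrum ℂ ((monodromy T a b l).map (fun x : ℝ => (x : ℂ))) := by
      rw [h]; exact Set.mem_insert _ _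
    have hre : Real.cos t = Real.cos (quasiMomentum T a b l) := by
      rcases (key _ hq _).1 hmem with h' | h'
      · simpa [Complex.exp_ofReal_mul_I_re] using congrArg Complex.re h'
      · have h2 := congrArg Complex.re h'
        rw [← neg_mul, ← Complex.ofReal_neg, Complex.exp_ofReal_mul_I_re,
          Complex.exp_ofReal_mul_I_re, Real.cos_neg] at h2
        exact h2
    have hm := quasiMomentum_mem hl
    exact Real.injOn_cos ⟨ht.1.le, ht.2.le⟩ ⟨hm.1.le, hm.2.le⟩ hre
  · rintro rfl
    ext z
    exact key _ hq z

/-- Rows of `J + Q` with index at least two. -/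
theorem act_jacobi_succ (a b : ℕ → ℝ) (q u : ℕ+ → ℝ) (m : ℕ+) :
    act (jacobiMatrix a b + Matrix.diagonal q) u (m + 1) =
      a m * u m + (b (m + 1 : ℕ+) + q (m + 1)) * u (m + 1) + a (m + 1 : ℕ+) * u (m + 1 + 1) := by
  have h1 : m ≠ m + 1 := (PNat.lt_add_right m 1).ne
  have h2 : m + 1 ≠ m + 1 + 1 := (PNat.lt_add_right (m + 1) 1).ne
  have h3 : m ≠ m + 1 + 1 := ((PNat.lt_add_right m 1).trans (PNat.lt_add_right (m + 1) 1)).ne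
  rw [act, tsum_eq_sum (s := {m, m + 1, m + 1 + 1})]
  · rw [Finset.sum_insert (by simp [h1, h3]), Finset.sum_insert (by simp [h2]),
      Finset.sum_singleton]
    simp [jacobiMatrix, h1.symm, h2]
    rw [if_neg h3]
    ring
  · intro n hn
    simp only [Finset.mem_insert, Finset.mem_singleton, not_or] at hn
    obtain ⟨n1, n2, n3⟩ := hn
    have n4 : ¬ m + 1 = n + 1 := fun h => n1 (add_right_cancel h).symm
    simp [jacobiMatrix, Ne.symm n2, n3]
    exact fun h => absurd h.symm n1

/-- The first row of `J + Q`. -/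
theorem act_jacobi_one (a b : ℕ → ℝ) (q u : ℕ+ → ℝ) :
    act (jacobiMatrix a b + Matrix.diagonal q) u 1 = (b 1 + q 1) * u 1 + a 1 * u (1 + 1) := by
  have h2 : (1 : ℕ+) ≠ 1 + 1 := by decide
  rw [act, tsum_eq_sum (s := {1, 1 + 1})]
  · rw [Finset.sum_insert (by simp [h2]), Finset.sum_singleton]
    simp [jacobiMatrix, h2]
  · intro n hn
    simp only [Finset.mem_insert, Finset.mem_singleton, not_or] at hn
    obtain ⟨n2, n3⟩ := hn
    have n4 : ¬ (1 : ℕ+) = n + 1 := (PNat.lt_add_left 1 n).ne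
    simp [jacobiMatrix, Ne.symm n2, n3, n4]

end PeriodicJacobi

namespace PeriodicJacobi
open scoped ComplexConjugate

/-! Let ψ be a normalised Bloch solution at λ and put φ_m = ψ_{m+1}. By variation of parameters the
perturbed solution is -Im (z_m φ_m), where the complex coordinate z evolves by `evo` and the
boundary condition fixes z_0. As ψ is bounded, z = O(1/m) yields an ℓ² eigenvector. Over a block, z
changes to first order by (i/2)(G z - A conj z), with G = Σ ρ |φ|² and A = Σ ρ conj(φ)². The mean G
only rotates z, while the resonant moment A can contract it. Under the hypotheses on the
quasi-momenta the squares of the Bloch solutions and their conjugates are linearly independent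
(`linearIndependent_resonance`), so A can be prescribed for finitely many eigenvalues at once
(`exists_pattern`). The exception is a constant diagonal b with λ + λ' = 2b: the factor (-1)^m then
turns the equation at λ with -ρ into the one at λ' with ρ. Hence each representative eigenvalue
carries two states, z under ρ and w under -ρ, and both must contract under the same A. The
contraction rate obtained is proportional to 1 - Re E with E = z conj(w) / (conj(z) w), which is no
use when E = 1. But G rotates z and w in opposite directions, so a large G makes Re E average out.
The function log |z| + η Im E captures this average: it drops by ε over a block with ρ = O(ε)
(`exists_lyapunov_step`, `exists_block`). On a block starting at s one takes ε = 2L/s, so the drops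
add up to about 2 log s. One of the two powers of s gained pays for the jumps of the Lyapunov
function when eigenvalues are added; these are added so slowly that K dominates the constants
(`exists_decaying`). -/

/-! ### Evolution of the Wronskian coordinate and its linearisation. -/

/-- The evolution of the Wronskian coordinate of a solution under the perturbation `ρ`, relative to
an unperturbed complex solution `φ`. -/
noncomputable def evo (φ : ℕ → ℂ) (ρ : ℕ → ℝ) (z : ℂ) : ℕ → ℂ
  | 0 => z
  | m + 1 => evo φ ρ z m - (ρ m * (evo φ ρ z m * φ m).im : ℝ) * conj (φ m)

theorem evo_zero (φ : ℕ → ℂ) (ρ : ℕ → ℝ) (z : ℂ) : evo φ ρ z 0 = z := rfl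

theorem evo_succ (φ : ℕ → ℂ) (ρ : ℕ → ℝ) (z : ℂ) (m : ℕ) :
    evo φ ρ z (m + 1) =
      evo φ ρ z m - (ρ m * (evo φ ρ z m * φ m).im : ℝ) * conj (φ m) := rfl

theorem evo_congr (φ : ℕ → ℂ) {ρ ρ' : ℕ → ℝ} (z : ℂ) {m : ℕ} (h : ∀ k < m, ρ k = ρ' k) :
    evo φ ρ z m = evo φ ρ' z m := by
  induction m with
  | zero => rfl
  | succ m ih =>
    rw [evo_succ, evo_succ, ih fun k hk => h k (by omega), h m (by omega)]

theorem evo_add (φ : ℕ → ℂ) (ρ : ℕ → ℝ) (z : ℂ) (n m : ℕ) :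
    evo φ ρ z (n + m) =
      evo (fun k => φ (n + k)) (fun k => ρ (n + k)) (evo φ ρ z n) m := by
  induction m with
  | zero => rfl
  | succ m ih => rw [← add_assoc, evo_succ, evo_succ, ih]

theorem evo_rotate (φ : ℕ → ℂ) (ρ : ℕ → ℝ) (z : ℂ) {ν : ℂ} (hν : ‖ν‖ = 1) (m : ℕ) :
    ν * evo (fun k => ν * φ k) ρ z m = evo φ ρ (ν * z) m := by
  have h1 : ν * conj ν = 1 := by
    rw [Complex.mul_conj, Complex.normSq_eq_norm_sq, hν]; norm_num
  induction m with
  | zero => rfl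
  | succ m ih =>
    rw [evo_succ, evo_succ, ← ih, map_mul]
    have : evo (fun k => ν * φ k) ρ z m * (ν * φ m) = ν * evo (fun k => ν * φ k) ρ z m * φ m := by
      ring
    rw [this]
    linear_combination (-((ρ m * (ν * evo (fun k => ν * φ k) ρ z m * φ m).im : ℝ) : ℂ)
      * conj (φ m)) * h1

/-- A step could reach 0 only from a real multiple of conj φ, but there Im (z φ) = 0 and the step is
trivial. -/
theorem evo_ne_zero (φ : ℕ → ℂ) (ρ : ℕ → ℝ) {z : ℂ} (hz : z ≠ 0) (m : ℕ) :
    evo φ ρ z m ≠ 0 := by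
  induction m with
  | zero => exact hz
  | succ m ih =>
    intro h
    rw [evo_succ, sub_eq_zero] at h
    set x := evo φ ρ z m
    have hx : (x * φ m).im = 0 := by
      rw [h, mul_assoc, mul_comm (conj (φ m)), Complex.mul_conj, ← Complex.ofReal_mul,
        Complex.ofReal_im]
    rw [hx] at h
    simp at h
    exact ih h

theorem norm_evo_sub_le {φ : ℕ → ℂ} {ρ : ℕ → ℝ} (z : ℂ) {B δ : ℝ} (hδ : 0 ≤ δ) (hB : 0 ≤ B)
    (hφ : ∀ m, ‖φ m‖ ^ 2 ≤ B) (hρ : ∀ m, |ρ m| ≤ δ) (m : ℕ) :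
    ‖evo φ ρ z m - z‖ ≤ ((1 + δ * B) ^ m - 1) * ‖z‖ := by
  induction m with
  | zero => simp [evo]
  | succ m ih =>
    have hx : ‖evo φ ρ z m‖ ≤ (1 + δ * B) ^ m * ‖z‖ := by
      have := norm_add_le (evo φ ρ z m - z) z
      rw [sub_add_cancel] at this
      linarith
    have h1 : ‖(((ρ m * (evo φ ρ z m * φ m).im : ℝ) : ℂ)) * conj (φ m)‖
        ≤ δ * B * ((1 + δ * B) ^ m * ‖z‖) := by
      rw [norm_mul, Complex.norm_real, norm_mul, Real.norm_eq_abs, Real.norm_eq_abs,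
        RCLike.norm_conj]
      have h2 : |(evo φ ρ z m * φ m).im| ≤ ‖evo φ ρ z m‖ * ‖φ m‖ := by
        rw [← norm_mul]; exact Complex.abs_im_le_norm _
      calc |ρ m| * |(evo φ ρ z m * φ m).im| * ‖φ m‖
          ≤ δ * (‖evo φ ρ z m‖ * ‖φ m‖) * ‖φ m‖ := by
            gcongr
            exact hρ m
        _ = δ * (‖φ m‖ ^ 2) * ‖evo φ ρ z m‖ := by ring
        _ ≤ _ := by
            gcongr
            exact hφ m
    have h3 : evo φ ρ z (m + 1) - z = (evo φ ρ z m - z) -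
        (((ρ m * (evo φ ρ z m * φ m).im : ℝ) : ℂ)) * conj (φ m) := by
      rw [evo_succ]; ring
    rw [h3]
    refine (norm_sub_le _ _).trans ?_
    rw [pow_succ]
    linarith

theorem pow_sub_one_le {x : ℝ} (hx : 0 ≤ x) {m L : ℕ} (hm : m ≤ L) (hL : L * x ≤ 1) :
    (1 + x) ^ m - 1 ≤ 2 * (L * x) := by
  have h1 : (1 + x) ^ m ≤ Real.exp (L * x) := by
    calc (1 + x) ^ m ≤ (1 + x) ^ L := pow_le_pow_right₀ (by linarith) hm
      _ ≤ (Real.exp x) ^ L := by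
          gcongr
          linarith [Real.add_one_le_exp x]
      _ = Real.exp (L * x) := (Real.exp_nat_mul x L).symm
  have h0 : 0 ≤ (L : ℝ) * x := by positivity
  have h2 := Real.abs_exp_sub_one_le (x := (L : ℝ) * x) (by rwa [abs_of_nonneg h0])
  rw [abs_of_nonneg h0] at h2
  linarith [le_abs_self (Real.exp (L * x) - 1)]

theorem norm_evo_le {φ : ℕ → ℂ} {ρ : ℕ → ℝ} (z : ℂ) {B δ : ℝ} (hδ : 0 ≤ δ) (hB : 0 ≤ B)
    (hφ : ∀ m, ‖φ m‖ ^ 2 ≤ B) (hρ : ∀ m, |ρ m| ≤ δ) {m L : ℕ} (hm : m ≤ L)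
    (hL : L * (δ * B) ≤ 1) : ‖evo φ ρ z m‖ ≤ 3 * ‖z‖ := by
  have h1 := norm_evo_sub_le z hδ hB hφ hρ m
  have h2 := pow_sub_one_le (mul_nonneg hδ hB) hm hL
  have h3 := norm_add_le (evo φ ρ z m - z) z
  rw [sub_add_cancel] at h3
  have h4 : ((1 + δ * B) ^ m - 1) * ‖z‖ ≤ 2 * ‖z‖ := by
    gcongr; linarith
  linarith

/-- The second order error of the linearisation of the evolution. -/
theorem norm_evo_sub_linear_le {φ : ℕ → ℂ} {ρ : ℕ → ℝ} (z : ℂ) {B δ : ℝ} (hδ : 0 ≤ δ)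
    (hB : 0 ≤ B) (hφ : ∀ m, ‖φ m‖ ^ 2 ≤ B) (hρ : ∀ m, |ρ m| ≤ δ) {m L : ℕ} (hm : m ≤ L)
    (hL : L * (δ * B) ≤ 1) :
    ‖evo φ ρ z m - (z - ∑ k ∈ Finset.range m, ((ρ k * (z * φ k).im : ℝ) : ℂ) * conj (φ k))‖
      ≤ m * (2 * L * (δ * B) ^ 2) * ‖z‖ := by
  induction m with
  | zero => simp [evo]
  | succ m ih =>
    have ih := ih (by omega)
    have h1 := norm_evo_sub_le z hδ hB hφ hρ m
    have h2 := pow_sub_one_le (mul_nonneg hδ hB) (show m ≤ L by omega) hL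
    have h5 : ‖evo φ ρ z m - z‖ ≤ 2 * (L * (δ * B)) * ‖z‖ :=
      h1.trans (by gcongr)
    have e : evo φ ρ z (m + 1) - (z - ∑ k ∈ Finset.range (m + 1),
          ((ρ k * (z * φ k).im : ℝ) : ℂ) * conj (φ k)) =
        (evo φ ρ z m - (z - ∑ k ∈ Finset.range m, ((ρ k * (z * φ k).im : ℝ) : ℂ) * conj (φ k)))
        - ((ρ m * ((evo φ ρ z m - z) * φ m).im : ℝ) : ℂ) * conj (φ m) := by
      rw [evo_succ, Finset.sum_range_succ, sub_mul, Complex.sub_im, mul_sub, Complex.ofReal_sub]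
      ring
    rw [e]
    have h6 : ‖((ρ m * ((evo φ ρ z m - z) * φ m).im : ℝ) : ℂ) * conj (φ m)‖ ≤
        2 * L * (δ * B) ^ 2 * ‖z‖ := by
      rw [norm_mul, Complex.norm_real, norm_mul, Real.norm_eq_abs, Real.norm_eq_abs,
        RCLike.norm_conj]
      have h2 : |((evo φ ρ z m - z) * φ m).im| ≤ ‖evo φ ρ z m - z‖ * ‖φ m‖ := by
        rw [← norm_mul]; exact Complex.abs_im_le_norm _
      calc |ρ m| * |((evo φ ρ z m - z) * φ m).im| * ‖φ m‖
          ≤ δ * (‖evo φ ρ z m - z‖ * ‖φ m‖) * ‖φ m‖ := by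
            gcongr
            exact hρ m
        _ = δ * (‖φ m‖ ^ 2) * ‖evo φ ρ z m - z‖ := by ring
        _ ≤ δ * B * (2 * (L * (δ * B)) * ‖z‖) := by
            gcongr
            exact hφ m
        _ = _ := by ring
    refine (norm_sub_le _ _).trans ?_
    rw [Nat.cast_succ]
    linarith

/-- The first order response of the evolution, in terms of the two moments of the perturbation. -/
theorem sum_im_mul_conj (φ : ℕ → ℂ) (ρ : ℕ → ℝ) (z : ℂ) (s : Finset ℕ) :
    ∑ k ∈ s, ((ρ k * (z * φ k).im : ℝ) : ℂ) * conj (φ k) =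
      -(Complex.I / 2) * (z * ((∑ k ∈ s, ρ k * ‖φ k‖ ^ 2 : ℝ) : ℂ) -
        conj z * ∑ k ∈ s, (ρ k : ℂ) * conj (φ k) ^ 2) := by
  push_cast
  rw [Finset.mul_sum, Finset.mul_sum, ← Finset.sum_sub_distrib, Finset.mul_sum]
  refine Finset.sum_congr rfl fun k _ => ?_
  have h1 : ((z * φ k).im : ℂ) = -(Complex.I / 2) * (z * φ k - conj z * conj (φ k)) := by
    rw [← map_mul, Complex.sub_conj]
    push_cast
    linear_combination ((z * φ k).im : ℂ) * Complex.I_sq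
  have h2 : (‖φ k‖ : ℂ) ^ 2 = φ k * conj (φ k) := by
    rw [Complex.mul_conj, Complex.normSq_eq_norm_sq]; push_cast; ring
  rw [h1, h2]; ring

/-! ### Lyapunov estimate for one block. -/

theorem log_norm_le (h : ℂ) (hh : h ≠ 0) : Real.log ‖h‖ ≤ (h - 1).re + ‖h - 1‖ ^ 2 / 2 := by
  have h1 := Real.log_le_sub_one_of_pos (x := ‖h‖ ^ 2) (by positivity)
  rw [Real.log_pow] at h1
  have h2 : ‖h‖ ^ 2 = 1 + 2 * (h - 1).re + ‖h - 1‖ ^ 2 := by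
    rw [← Complex.normSq_eq_norm_sq, ← Complex.normSq_eq_norm_sq, Complex.normSq_apply,
      Complex.normSq_apply]
    simp; ring
  push_cast at h1
  linarith

/-- The quotient is exp(2i arg(1 + p)), the factor by which the phase difference `E` moves. -/
theorem norm_div_conj_sub_le {p : ℂ} (hp : ‖p‖ ≤ 1 / 2) :
    ‖(1 + p) / conj (1 + p) - 1 - 2 * p.im * Complex.I‖ ≤ 4 * ‖p‖ ^ 2 := by
  have h0 : 1 / 2 ≤ ‖1 + p‖ := by
    have := norm_sub_le (1 + p) p
    simp at this
    linarith
  have h1 : conj (1 + p) ≠ 0 := by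
    rw [Ne, map_eq_zero, ← norm_eq_zero]; linarith
  have h2 : (2 * p.im * Complex.I : ℂ) = p - conj p := by rw [Complex.sub_conj]; push_cast; ring
  have h3 : (1 + p) / conj (1 + p) - 1 - 2 * p.im * Complex.I =
      -(conj p * (2 * p.im * Complex.I)) / conj (1 + p) := by
    rw [eq_div_iff h1, h2, sub_mul, sub_mul, div_mul_cancel₀ _ h1, map_add, map_one]
    ring
  rw [h3, norm_div, norm_neg, norm_mul, RCLike.norm_conj, RCLike.norm_conj, norm_mul, norm_mul]
  simp only [Complex.norm_I, Complex.norm_real, Real.norm_eq_abs, Complex.norm_ofNat, mul_one]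
  rw [div_le_iff₀ (by linarith)]
  have := Complex.abs_im_le_norm p
  nlinarith [norm_nonneg p, mul_le_mul_of_nonneg_left this (norm_nonneg p),
    mul_le_mul_of_nonneg_left h0 (sq_nonneg ‖p‖)]

set_option maxHeartbeats 1000000 in
/-- One step of the Lyapunov function `log ‖z‖ + η Im E` decreases it, for a perturbation of
resonant strength `ε` whose mean `ε (g + δ)` dominates. -/
theorem exists_lyapunov_step (g D C : ℝ) (hD : 0 ≤ D) (hC : 0 ≤ C) (hg : 4 * D + 16 ≤ |g|) :
    ∃ ε₀ > 0, ∀ (ε δ : ℝ) (E h h' : ℂ), 0 < ε → ε ≤ ε₀ → |δ| ≤ D → ‖E‖ = 1 → h ≠ 0 →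
      ‖h - (1 + (ε * (g + δ) / 2 * Complex.I - 4 * ε * (1 - conj E)))‖ ≤ C * ε ^ 2 →
      ‖h' - (1 + (ε * (g + δ) / 2 * Complex.I - 4 * ε * (1 - conj E)))‖ ≤ C * ε ^ 2 →
      Real.log ‖h‖ + (-2 / g) * (E * (h * h' / conj (h * h'))).im ≤ (-2 / g) * E.im - ε := by
  have hg0 : 0 < |g| := by linarith
  have hg1 : g ≠ 0 := abs_pos.1 hg0
  obtain ⟨M, hM⟩ : ∃ M, M = |g| + D + 8 + C := ⟨_, rfl⟩
  have hM8 : 8 ≤ M := by linarith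
  have hK : 0 < 5 * C + 39 * M ^ 2 := by positivity
  -- `M * ε` bounds ‖h - 1‖ and ‖h' - 1‖, so ε ≤ 1/(8M) keeps ‖h h' - 1‖ below 1/2. The constant 5C
  -- + 39M² collects all second order errors, which then cost at most ε.
  refine ⟨min 1 (min (1 / (8 * M)) (1 / (5 * C + 39 * M ^ 2))), by positivity, ?_⟩
  intro ε δ E h h' hε hε0 hδ hE hh h1 h2
  obtain ⟨hε1, hε0⟩ := le_min_iff.1 hε0
  obtain ⟨hε2, hε3⟩ := le_min_iff.1 hε0
  rw [le_div_iff₀ (by positivity)] at hε2 hε3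
  set a : ℂ := ε * (g + δ) / 2 * Complex.I - 4 * ε * (1 - conj E) with ha
  have hεε : ε ^ 2 ≤ ε := by nlinarith
  have hare : a.re = -4 * ε * (1 - E.re) := by
    simp [ha, Complex.mul_re]
  have haim : a.im = ε * (g + δ) / 2 - 4 * ε * E.im := by
    simp [ha, Complex.mul_im]
  have han : ‖a‖ ≤ (|g| + D + 8) * ε := by
    have e1 : ‖(ε * (g + δ) / 2 * Complex.I : ℂ)‖ ≤ (|g| + D) * ε := by
      have : (ε * (g + δ) / 2 * Complex.I : ℂ) = ((ε * (g + δ) / 2 : ℝ) : ℂ) * Complex.I := by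
        push_cast; ring
      rw [this, norm_mul, Complex.norm_I, Complex.norm_real, mul_one, Real.norm_eq_abs, abs_div,
        abs_mul, abs_of_pos hε, abs_two]
      have := abs_add_le g δ
      nlinarith [abs_nonneg g, abs_nonneg δ]
    have e2 : ‖(4 * ε * (1 - conj E) : ℂ)‖ ≤ 8 * ε := by
      rw [norm_mul, norm_mul, Complex.norm_real, Real.norm_eq_abs, abs_of_pos hε]
      have := norm_sub_le 1 (conj E)
      rw [RCLike.norm_conj, hE, norm_one] at this
      norm_num
      nlinarith
    refine (norm_sub_le _ _).trans ?_
    linarith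
  -- the increments
  have hb : ∀ x : ℂ, ‖x - (1 + a)‖ ≤ C * ε ^ 2 → ‖x - 1‖ ≤ M * ε := by
    intro x hx
    have e : x - 1 = (x - (1 + a)) + a := by ring
    rw [e]
    refine (norm_add_le _ _).trans ?_
    rw [hM]
    nlinarith
  have hb1 := hb h h1
  have hb2 := hb h' h2
  have hMε : M * ε ≤ 1 / 8 := by linarith
  obtain ⟨p, hp⟩ : ∃ p, p = h * h' - 1 := ⟨_, rfl⟩
  have hbb : ‖(h - 1) * (h' - 1)‖ ≤ M ^ 2 * ε ^ 2 := by
    rw [norm_mul]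
    calc _ ≤ (M * ε) * (M * ε) := by gcongr
      _ = _ := by ring
  have hpn : ‖p‖ ≤ 3 * M * ε := by
    have e : p = (h - 1) + (h' - 1) + (h - 1) * (h' - 1) := by rw [hp]; ring
    rw [e]
    have := norm_add₃_le (a := h - 1) (b := h' - 1) (c := (h - 1) * (h' - 1))
    nlinarith [mul_pos (show 0 < M by linarith) hε]
  have hpa : ‖p - 2 * a‖ ≤ (2 * C + M ^ 2) * ε ^ 2 := by
    have e : p - 2 * a = (h - (1 + a)) + (h' - (1 + a)) + (h - 1) * (h' - 1) := by rw [hp]; ring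
    rw [e]
    have := norm_add₃_le (a := h - (1 + a)) (b := h' - (1 + a)) (c := (h - 1) * (h' - 1))
    linarith
  have hdiv := norm_div_conj_sub_le (p := p) (by linarith)
  have hp1 : 1 + p = h * h' := by rw [hp]; ring
  rw [hp1] at hdiv
  have hlog := log_norm_le h hh
  have hre : (h - 1).re ≤ a.re + C * ε ^ 2 := by
    have := (Complex.abs_re_le_norm (h - (1 + a))).trans h1
    have := (abs_le.1 this).2
    simp at this ⊢
    linarith
  have him : |p.im - 2 * a.im| ≤ (2 * C + M ^ 2) * ε ^ 2 := by
    have := (Complex.abs_im_le_norm (p - 2 * a)).trans hpa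
    simpa using this
  have hEn : |(E * (h * h' / conj (h * h'))).im - (E.im + 2 * p.im * E.re)| ≤ 36 * M ^ 2 * ε ^ 2 := by
    have e : (E * (h * h' / conj (h * h'))).im - (E.im + 2 * p.im * E.re) =
        (E * (h * h' / conj (h * h') - 1 - 2 * p.im * Complex.I)).im := by
      rw [mul_sub, mul_sub, Complex.sub_im, Complex.sub_im]
      simp [Complex.mul_im]
      ring
    rw [e]
    refine (Complex.abs_im_le_norm _).trans ?_
    rw [norm_mul, hE, one_mul]
    refine hdiv.trans ?_
    calc 4 * ‖p‖ ^ 2 ≤ 4 * (3 * M * ε) ^ 2 := by gcongr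
      _ = _ := by ring
  have hER : |E.re| ≤ 1 := (Complex.abs_re_le_norm E).trans hE.le
  have hEI : |E.im| ≤ 1 := (Complex.abs_im_le_norm E).trans hE.le
  obtain ⟨η, hη⟩ : ∃ η, η = -2 / g := ⟨_, rfl⟩
  have hηg : η * g = -2 := by rw [hη]; field_simp
  have hηa : |η| * |g| = 2 := by rw [← abs_mul, hηg]; norm_num
  have hη1 : |η| ≤ 1 := by
    nlinarith [abs_nonneg η]
  rw [← hη]
  -- the change of the oscillating term
  have hosc : |η * ((E * (h * h' / conj (h * h'))).im - E.im) - η * (4 * a.im * E.re)| ≤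
      (36 * M ^ 2 + 2 * (2 * C + M ^ 2)) * ε ^ 2 := by
    rw [← mul_sub, abs_mul]
    have e : (E * (h * h' / conj (h * h'))).im - E.im - 4 * a.im * E.re =
      ((E * (h * h' / conj (h * h'))).im - (E.im + 2 * p.im * E.re)) +
        2 * (p.im - 2 * a.im) * E.re := by ring
    have e2 : |2 * (p.im - 2 * a.im) * E.re| ≤ 2 * ((2 * C + M ^ 2) * ε ^ 2) := by
      rw [abs_mul, abs_mul, abs_two]
      have := mul_le_mul him hER (abs_nonneg _) (by positivity)
      linarith
    rw [e]
    have e3 := (abs_add_le ((E * (h * h' / conj (h * h'))).im - (E.im + 2 * p.im * E.re))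
      (2 * (p.im - 2 * a.im) * E.re)).trans (add_le_add hEn e2)
    calc _ ≤ 1 * (36 * M ^ 2 * ε ^ 2 + 2 * ((2 * C + M ^ 2) * ε ^ 2)) := by gcongr
      _ = _ := by ring
  have hosc2 := (abs_le.1 hosc).2
  have hb1' : ‖h - 1‖ ^ 2 ≤ M ^ 2 * ε ^ 2 := by
    calc _ ≤ (M * ε) ^ 2 := by gcongr
      _ = _ := by ring
  -- As η g = -2, the rotation contributes -4ε Re E, cancelling the +4ε Re E in `a.re`. The total is
  -- -4ε, plus 2ε from `δ` and `E.im`, plus ε from the second order terms.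
  have hmain : η * (4 * a.im * E.re) ≤ -4 * ε * E.re + 2 * ε := by
    rw [haim]
    have e1 : η * (4 * (ε * (g + δ) / 2 - 4 * ε * E.im) * E.re) =
      -4 * ε * E.re + ε * ((2 * (η * δ) - 16 * η * E.im) * E.re) := by
      linear_combination (2 * ε * E.re) * hηg
    have e2 : |2 * (η * δ) - 16 * η * E.im| ≤ 2 := by
      have f1 : |2 * (η * δ)| ≤ 2 * (|η| * D) := by
        rw [abs_mul, abs_mul, abs_two]; gcongr
      have f2 : |16 * η * E.im| ≤ 16 * |η| := by
        rw [abs_mul, abs_mul, abs_of_pos (by norm_num : (0:ℝ) < 16)]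
        exact mul_le_of_le_one_right (by positivity) hEI
      have f3 := abs_sub (2 * (η * δ)) (16 * η * E.im)
      have f4 : |η| * (4 * D + 16) ≤ 2 := by
        rw [← hηa]; gcongr
      have f5 := mul_nonneg (abs_nonneg η) hD
      linarith
    have e3 : (2 * (η * δ) - 16 * η * E.im) * E.re ≤ 2 := by
      refine (le_abs_self _).trans ?_
      rw [abs_mul]
      exact (mul_le_of_le_one_right (abs_nonneg _) hER).trans e2
    rw [e1]
    have e4 := mul_le_mul_of_nonneg_left e3 hε.le
    linarith
  rw [hare] at hre
  have hfin := mul_le_mul_of_nonneg_left hε3 hε.le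
  nlinarith

/-! ### Perturbations with prescribed moments. -/

/-- The functions whose linear independence controls which first order responses are possible: the
squares of the `φ r`, their conjugates, and one squared modulus. -/
noncomputable def resonance {ι : Type*} (φ : ι → ℕ → ℂ) (r₀ : ι) : Option (ι × Bool) → ℕ → ℂ
  | none => fun m => ((‖φ r₀ m‖ ^ 2 : ℝ) : ℂ)
  | some (r, true) => fun m => φ r m ^ 2
  | some (r, false) => fun m => conj (φ r m) ^ 2

/-- A functional killing every vector (v i m)_i would be a linear relation among the `v i`, so these
vectors span. -/
theorem exists_finsupp_of_linearIndependent {κ : Type*} [Fintype κ] {v : κ → ℕ → ℂ}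
    (hv : LinearIndependent ℂ v) (t : κ → ℂ) :
    ∃ ρ : ℕ →₀ ℂ, ∀ i, Finsupp.linearCombination ℂ (v i) ρ = t i := by
  classical
  set Φ := Finsupp.linearCombination ℂ (fun m : ℕ => fun i => v i m) with hΦ
  have hsurj : LinearMap.range Φ = ⊤ := by
    by_contra hne
    obtain ⟨f, hf0, hf⟩ := Submodule.exists_le_ker_of_lt_top _ (lt_top_iff_ne_top.2 hne)
    have hf1 : ∀ x : κ → ℂ, f x = ∑ i, f (Pi.single i 1) * x i := by
      intro x
      conv_lhs => rw [← Finset.univ_sum_single x]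
      rw [map_sum]
      refine Finset.sum_congr rfl fun i _ => ?_
      have : (Pi.single i (x i) : κ → ℂ) = x i • Pi.single i 1 := by
        rw [← Pi.single_smul, smul_eq_mul, mul_one]
      rw [this, map_smul, smul_eq_mul, mul_comm]
    have h0 : ∑ i, f (Pi.single i 1) • v i = 0 := by
      ext m
      have h1 : f (fun i => v i m) = 0 := by
        refine hf ⟨Finsupp.single m 1, ?_⟩
        simp [hΦ]
      rw [hf1] at h1
      simpa using h1
    have h2 := Fintype.linearIndependent_iff.1 hv _ h0
    refine hf0 (LinearMap.ext fun x => ?_)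
    rw [hf1 x]
    simp [h2]
  obtain ⟨ρ, hρ⟩ := LinearMap.range_eq_top.1 hsurj t
  refine ⟨ρ, fun i => ?_⟩
  rw [← hρ, hΦ, Finsupp.linearCombination_apply, Finsupp.linearCombination_apply, Finsupp.sum,
    Finsupp.sum, Finset.sum_apply]
  rfl

/-- The resonant moment of a perturbation. -/
noncomputable def resMoment (φ : ℕ → ℂ) : (ℕ →₀ ℝ) →ₗ[ℝ] ℂ :=
  Finsupp.linearCombination ℝ fun m => conj (φ m) ^ 2

/-- The mean moment of a perturbation. -/
noncomputable def meanMoment (φ : ℕ → ℂ) : (ℕ →₀ ℝ) →ₗ[ℝ] ℝ :=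
  Finsupp.linearCombination ℝ fun m => ‖φ m‖ ^ 2

theorem resMoment_eq_sum (φ : ℕ → ℂ) (ρ : ℕ →₀ ℝ) {s : Finset ℕ} (hs : ρ.support ⊆ s) :
    resMoment φ ρ = ∑ k ∈ s, (ρ k : ℂ) * conj (φ k) ^ 2 := by
  rw [resMoment, Finsupp.linearCombination_apply, Finsupp.sum_of_support_subset _ hs _ (by simp)]
  simp

theorem meanMoment_eq_sum (φ : ℕ → ℂ) (ρ : ℕ →₀ ℝ) {s : Finset ℕ} (hs : ρ.support ⊆ s) :
    meanMoment φ ρ = ∑ k ∈ s, ρ k * ‖φ k‖ ^ 2 := by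
  rw [meanMoment, Finsupp.linearCombination_apply, Finsupp.sum_of_support_subset _ hs _ (by simp)]
  simp

/-- Giving the moments against φ² and conj(φ)² conjugate targets ensures that the real part of a
complex solution has the same resonant moments. -/
theorem exists_pattern {ι : Type*} (φ : ι → ℕ → ℂ) (F : Finset ι) (r₀ : ι)
    (hind : LinearIndependent ℂ (resonance φ r₀)) (c : ι → ℂ) (g : ℝ) :
    ∃ ρ : ℕ →₀ ℝ, (∀ r ∈ F, resMoment (φ r) ρ = c r) ∧ meanMoment (φ r₀) ρ = g := by
  have hind' : LinearIndependent ℂ (fun o : Option (F × Bool) =>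
      resonance φ r₀ (o.map (Prod.map Subtype.val id))) :=
    hind.comp _ (Option.map_injective
      (Function.Injective.prodMap Subtype.val_injective Function.injective_id))
  obtain ⟨ρ, hρ⟩ := exists_finsupp_of_linearIndependent hind' fun o =>
    match o with
    | none => (g : ℂ)
    | some (r, true) => conj (c r)
    | some (r, false) => c r
  refine ⟨ρ.mapRange Complex.re Complex.zero_re, fun r hr => ?_, ?_⟩
  · have h1 := hρ (some (⟨r, hr⟩, true))
    have h2 := hρ (some (⟨r, hr⟩, false))
    simp only [Option.map_some, Prod.map_apply, id, resonance,
      Finsupp.linearCombination_apply, Finsupp.sum, smul_eq_mul] at h1 h2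
    rw [resMoment_eq_sum _ _ (Finsupp.support_mapRange (hf := Complex.zero_re))]
    have h3 := congrArg conj h1
    rw [map_sum, Complex.conj_conj] at h3
    have h4 : ∀ k, ((ρ k).re : ℂ) = (ρ k + conj (ρ k)) / 2 := fun k => by
      rw [Complex.add_conj]; simp
    simp only [Finsupp.mapRange_apply, h4, add_mul, add_div]
    rw [Finset.sum_add_distrib]
    have h5 : ∑ k ∈ ρ.support, ρ k / 2 * conj (φ r k) ^ 2 = c r / 2 := by
      rw [← h2, Finset.sum_div]; exact Finset.sum_congr rfl fun k _ => by ring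
    have h6 : ∑ k ∈ ρ.support, conj (ρ k) / 2 * conj (φ r k) ^ 2 = c r / 2 := by
      rw [← h3, Finset.sum_div]
      exact Finset.sum_congr rfl fun k _ => by rw [map_mul, map_pow]; ring
    rw [h5, h6, add_halves]
  · have h1 := hρ none
    simp only [Option.map_none, resonance,
      Finsupp.linearCombination_apply, Finsupp.sum, smul_eq_mul] at h1
    rw [meanMoment_eq_sum _ _ (Finsupp.support_mapRange (hf := Complex.zero_re))]
    have h2 := congrArg Complex.re h1
    rw [Complex.re_sum, Complex.ofReal_re] at h2
    rw [← h2]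
    refine Finset.sum_congr rfl fun k _ => ?_
    rw [Complex.re_mul_ofReal]; rfl

/-- There is a non-resonant perturbation all of whose mean moments are non-zero. -/
theorem exists_mean_pattern {ι : Type*} (φ : ι → ℕ → ℂ) (F : Finset ι)
    (hind : ∀ r₀, LinearIndependent ℂ (resonance φ r₀)) :
    ∃ ρ : ℕ →₀ ℝ, ∀ r ∈ F, resMoment (φ r) ρ = 0 ∧ meanMoment (φ r) ρ ≠ 0 := by
  classical
  set K : Submodule ℝ (ℕ →₀ ℝ) := ⨅ r ∈ F, LinearMap.ker (resMoment (φ r)) with hK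
  have hmem : ∀ ρ : ℕ →₀ ℝ, ρ ∈ K ↔ ∀ r ∈ F, resMoment (φ r) ρ = 0 := by
    intro ρ; simp [hK, Submodule.mem_iInf]
  -- Each kernel is a proper subspace of `K`, and finitely many proper subspaces over the infinite
  -- field ℝ do not cover `K`.
  set s : Finset (Subspace ℝ K) :=
    F.image fun r => LinearMap.ker ((meanMoment (φ r)).domRestrict K) with hs
  have htop : ⊤ ∉ s := by
    intro h
    obtain ⟨r, _, hr⟩ := Finset.mem_image.1 h
    obtain ⟨ρ, h1, h2⟩ := exists_pattern φ F r (hind r) 0 1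
    have h3 : (⟨ρ, (hmem ρ).2 h1⟩ : K) ∈ LinearMap.ker ((meanMoment (φ r)).domRestrict K) := by
      rw [hr]; trivial
    rw [LinearMap.mem_ker, LinearMap.domRestrict_apply, h2] at h3
    exact one_ne_zero h3
  obtain ⟨ρ, hρ⟩ := (Set.ne_univ_iff_exists_notMem _).1
    (Subspace.biUnion_ne_univ_of_top_notMem htop)
  refine ⟨ρ, fun r hr => ⟨(hmem _).1 ρ.2 r hr, fun h => hρ ?_⟩⟩
  refine Set.mem_biUnion (Finset.mem_image_of_mem _ hr) ?_
  simpa using h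

theorem exists_abs_finsupp_le (ρ : ℕ →₀ ℝ) : ∃ C, 0 ≤ C ∧ ∀ m, |ρ m| ≤ C := by
  refine ⟨∑ k ∈ ρ.support, |ρ k|, by positivity, fun m => ?_⟩
  by_cases hm : m ∈ ρ.support
  · exact Finset.single_le_sum (f := fun k => |ρ k|) (fun _ _ => abs_nonneg _) hm
  · rw [Finsupp.notMem_support_iff.1 hm, abs_zero]
    positivity

theorem exists_pos_forall_le {ι : Type*} (F : Finset ι) (e : ι → ℝ) (he : ∀ r ∈ F, 0 < e r) :
    ∃ ε > 0, ∀ r ∈ F, ε ≤ e r := by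
  classical
  induction F using Finset.induction_on with
  | empty => exact ⟨1, one_pos, by simp⟩
  | insert a s ha ih =>
    obtain ⟨ε, h0, h⟩ := ih fun r hr => he r (Finset.mem_insert_of_mem hr)
    refine ⟨min ε (e a), lt_min h0 (he a (Finset.mem_insert_self _ _)), fun r hr => ?_⟩
    rcases Finset.mem_insert.1 hr with rfl | hr
    · exact min_le_right _ _
    · exact (min_le_left _ _).trans (h r hr)

/-- The imaginary part of the phase difference of two states. -/
noncomputable def phase (z w : ℂ) : ℝ := (z * conj w / (conj z * w)).im

theorem abs_phase_le (z w : ℂ) : |phase z w| ≤ 1 := by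
  refine (Complex.abs_im_le_norm _).trans ?_
  rw [norm_div, norm_mul, norm_mul, RCLike.norm_conj, RCLike.norm_conj]
  exact div_self_le_one _

theorem phase_rotate (z w : ℂ) {ν : ℂ} (hν : ‖ν‖ = 1) : phase (ν * z) (ν * w) = phase z w := by
  have h1 : ν * conj ν = 1 := by
    rw [Complex.mul_conj, Complex.normSq_eq_norm_sq, hν]; norm_num
  rw [phase, phase]
  congr 1
  rw [map_mul, map_mul]
  have h2 : ν * z * (conj ν * conj w) = z * conj w := by linear_combination z * conj w * h1
  have h3 : conj ν * conj z * (ν * w) = conj z * w := by linear_combination conj z * w * h1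
  rw [h2, h3]

/-- The bounds are uniform in `c` because the patterns are real combinations of fixed ones, with
moment 1 or I at one index and 0 at the others. The bound 16 suits c = -8i (z / conj z - w / conj
w). -/
theorem exists_resonant_pattern {ι : Type*} (φ : ι → ℕ → ℂ) (F : Finset ι)
    (hind : ∀ r₀, LinearIndependent ℂ (resonance φ r₀)) :
    ∃ (L : ℕ) (C D : ℝ), 0 ≤ C ∧ 0 ≤ D ∧ ∀ c : ι → ℂ, (∀ r, ‖c r‖ ≤ 16) →
      ∃ ρ : ℕ →₀ ℝ, ρ.support ⊆ Finset.range L ∧ (∀ m, |ρ m| ≤ C) ∧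
        ∀ r ∈ F, resMoment (φ r) ρ = c r ∧ |meanMoment (φ r) ρ| ≤ D := by
  classical
  have h1 : ∀ (a : ℂ) (r : ι), ∃ ρ : ℕ →₀ ℝ, ∀ s ∈ F,
      resMoment (φ s) ρ = if s = r then a else 0 := fun a r => by
    obtain ⟨ρ, hρ, _⟩ := exists_pattern φ F r (hind r) (fun s => if s = r then a else 0) 0
    exact ⟨ρ, hρ⟩
  choose P hP using h1
  choose B hB0 hB using fun (a : ℂ) (r : ι) => exists_abs_finsupp_le (P a r)
  set Q : (ι → ℂ) → (ℕ →₀ ℝ) := fun c =>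
    ∑ r ∈ F, ((c r).re • P 1 r + (c r).im • P Complex.I r) with hQ
  obtain ⟨L, hL⟩ : ∃ L : ℕ, ∀ r ∈ F, (P 1 r).support ∪ (P Complex.I r).support ⊆ Finset.range L := by
    obtain ⟨L, hL⟩ := Finset.exists_nat_subset_range
      (F.biUnion fun r => (P 1 r).support ∪ (P Complex.I r).support)
    exact ⟨L, fun r hr => (Finset.subset_biUnion_of_mem
      (fun r => (P 1 r).support ∪ (P Complex.I r).support) hr).trans hL⟩
  refine ⟨L, ∑ r ∈ F, (16 * B 1 r + 16 * B Complex.I r),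
    ∑ s ∈ F, ∑ r ∈ F, (16 * |meanMoment (φ s) (P 1 r)| + 16 * |meanMoment (φ s) (P Complex.I r)|),
    Finset.sum_nonneg fun r _ => by have := hB0 1 r; have := hB0 Complex.I r; positivity,
    by positivity, fun c hc => ⟨Q c, ?_, fun m => ?_, fun s hs => ⟨?_, ?_⟩⟩⟩
  · intro m hm
    by_contra hmL
    refine Finsupp.mem_support_iff.1 hm ?_
    rw [hQ, Finsupp.finsetSum_apply]
    refine Finset.sum_eq_zero fun r hr => ?_
    have h2 := fun h => hmL (hL r hr (Finset.mem_union_left _ h))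
    have h3 := fun h => hmL (hL r hr (Finset.mem_union_right _ h))
    simp [Finsupp.notMem_support_iff.1 h2, Finsupp.notMem_support_iff.1 h3]
  · rw [hQ, Finsupp.finsetSum_apply]
    refine (Finset.abs_sum_le_sum_abs _ _).trans (Finset.sum_le_sum fun r _ => ?_)
    rw [Finsupp.add_apply, Finsupp.smul_apply, Finsupp.smul_apply, smul_eq_mul, smul_eq_mul]
    refine (abs_add_le _ _).trans ?_
    rw [abs_mul, abs_mul]
    have h2 := (Complex.abs_re_le_norm _).trans (hc r)
    have h3 := (Complex.abs_im_le_norm _).trans (hc r)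
    exact add_le_add (mul_le_mul h2 (hB _ _ _) (abs_nonneg _) (by norm_num))
      (mul_le_mul h3 (hB _ _ _) (abs_nonneg _) (by norm_num))
  · rw [hQ, map_sum, Finset.sum_eq_single s]
    · rw [map_add, map_smul, map_smul, hP _ _ _ hs, hP _ _ _ hs, if_pos rfl, if_pos rfl]
      simp
    · intro r _ hrs
      rw [map_add, map_smul, map_smul, hP _ _ _ hs, hP _ _ _ hs, if_neg hrs.symm, if_neg hrs.symm]
      simp
    · exact fun h => absurd hs h
  · refine le_trans ?_ (Finset.single_le_sum (f := fun s => ∑ r ∈ F,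
      (16 * |meanMoment (φ s) (P 1 r)| + 16 * |meanMoment (φ s) (P Complex.I r)|))
      (fun _ _ => by positivity) hs)
    rw [hQ, map_sum]
    refine (Finset.abs_sum_le_sum_abs _ _).trans (Finset.sum_le_sum fun r _ => ?_)
    rw [map_add, map_smul, map_smul, smul_eq_mul, smul_eq_mul]
    refine (abs_add_le _ _).trans ?_
    rw [abs_mul, abs_mul]
    have h2 := (Complex.abs_re_le_norm _).trans (hc r)
    have h3 := (Complex.abs_im_le_norm _).trans (hc r)
    gcongr

/-! ### The block lemma. -/

/-- The relative first order change of both states under a perturbation with the resonant moment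
that makes them decay. -/
theorem evo_div_sub_le {φ : ℕ → ℂ} {B : ℝ} (hB : 0 ≤ B) (hφ : ∀ m, ‖φ m‖ ^ 2 ≤ B) {ρ : ℕ →₀ ℝ}
    {δ : ℝ} (hδ : 0 ≤ δ) (hρ : ∀ m, |ρ m| ≤ δ) {L : ℕ} (hs : ρ.support ⊆ Finset.range L)
    (hL : L * (δ * B) ≤ 1) {z w : ℂ} (hz : z ≠ 0) (hw : w ≠ 0) {ε : ℝ}
    (hA : resMoment φ ρ = ε * (-8 * Complex.I * (z / conj z - w / conj w))) :
    ‖evo φ ρ z L / z - (1 + ((meanMoment φ ρ : ℂ) / 2 * Complex.I -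
        4 * ε * (1 - conj (z * conj w / (conj z * w)))))‖ ≤ L * (2 * L * (δ * B) ^ 2) ∧
    ‖conj (evo φ (-ρ) w L / w) - (1 + ((meanMoment φ ρ : ℂ) / 2 * Complex.I -
        4 * ε * (1 - conj (z * conj w / (conj z * w)))))‖ ≤ L * (2 * L * (δ * B) ^ 2) := by
  have hz' : conj z ≠ 0 := by simpa using hz
  have hw' : conj w ≠ 0 := by simpa using hw
  have hI := Complex.I_sq
  have h1 := norm_evo_sub_linear_le z hδ hB hφ hρ le_rfl hL
  have h2 := norm_evo_sub_linear_le (ρ := -ρ) w hδ hB hφ (by simpa using hρ) le_rfl hL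
  rw [sum_im_mul_conj, ← resMoment_eq_sum φ ρ hs, ← meanMoment_eq_sum φ ρ hs, hA] at h1
  have e2 : ∑ k ∈ Finset.range L, (((-⇑ρ) k * (w * φ k).im : ℝ) : ℂ) * conj (φ k) =
      -∑ k ∈ Finset.range L, ((ρ k * (w * φ k).im : ℝ) : ℂ) * conj (φ k) := by
    rw [← Finset.sum_neg_distrib]
    exact Finset.sum_congr rfl fun k _ => by push_cast [Pi.neg_apply]; ring
  rw [e2, sum_im_mul_conj, ← resMoment_eq_sum φ ρ hs, ← meanMoment_eq_sum φ ρ hs, hA] at h2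
  constructor
  · rw [← mul_le_mul_iff_left₀ (norm_pos_iff.2 hz), ← norm_mul]
    refine le_of_eq_of_le (congrArg norm ?_) h1
    rw [sub_mul, div_mul_cancel₀ _ hz]
    congr 1
    simp only [map_div₀, map_mul, Complex.conj_conj]
    field_simp
    linear_combination (-8 * ε * (z * conj w - conj z * w) : ℂ) * hI
  -- Conjugation undoes the sign of -ρ in front of the mean, so w obeys the same expansion as z.
  · rw [← RCLike.norm_conj, map_sub, Complex.conj_conj,
      ← mul_le_mul_iff_left₀ (norm_pos_iff.2 hw), ← norm_mul]
    refine le_of_eq_of_le (congrArg norm ?_) h2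
    rw [sub_mul, div_mul_cancel₀ _ hw]
    congr 1
    simp only [map_div₀, map_mul, map_add, map_sub, map_one, Complex.conj_conj, Complex.conj_I,
      Complex.conj_ofReal, map_ofNat]
    field_simp
    linear_combination (8 * ε * (z * conj w - conj z * w) : ℂ) * hI

theorem phase_div_mul {z w z' w' : ℂ} (hz : z ≠ 0) (hw : w ≠ 0) :
    phase z' w' = (z * conj w / (conj z * w) *
      (z' / z * conj (w' / w) / conj (z' / z * conj (w' / w)))).im := by
  have hz' : conj z ≠ 0 := by simpa using hz
  have hw' : conj w ≠ 0 := by simpa using hw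
  rw [phase]
  congr 1
  simp only [map_mul, map_div₀, Complex.conj_conj]
  rw [div_mul_div_comm, div_mul_div_comm, div_mul_div_comm]
  by_cases h : conj z' * w' = 0
  · have : conj z' = 0 ∨ w' = 0 := mul_eq_zero.1 h
    rcases this with h | h
    · simp [h]
    · simp [h]
  · have h1 : conj z' ≠ 0 := left_ne_zero_of_mul h
    have h2 : w' ≠ 0 := right_ne_zero_of_mul h
    field_simp

/-- Block lemma: over a block of fixed length, a perturbation of size `C * ε` decreases the
Lyapunov functions of finitely many pairs of states by `ε`. -/
theorem exists_block {ι : Type*} (φ : ι → ℕ → ℂ)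
    (hind : ∀ r₀, LinearIndependent ℂ (resonance φ r₀)) (hbd : ∀ r, ∃ B, ∀ m, ‖φ r m‖ ≤ B)
    (F : Finset ι) {T : ℕ} (hT : 0 < T) :
    ∃ (L : ℕ) (C ε₀ : ℝ) (η : ι → ℝ), 0 < L ∧ T ∣ L ∧ 0 ≤ C ∧ 0 < ε₀ ∧ (∀ r, |η r| ≤ 1) ∧
      ∀ z w : ι → ℂ, (∀ r, z r ≠ 0) → (∀ r, w r ≠ 0) → ∀ ε, 0 < ε → ε ≤ ε₀ →
        ∃ ρ : ℕ → ℝ, (∀ m, |ρ m| ≤ C * ε) ∧ ∀ r ∈ F,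
          (Real.log ‖evo (φ r) ρ (z r) L‖ +
              η r * phase (evo (φ r) ρ (z r) L) (evo (φ r) (-ρ) (w r) L) ≤
            Real.log ‖z r‖ + η r * phase (z r) (w r) - ε) ∧
          (Real.log ‖evo (φ r) (-ρ) (w r) L‖ +
              η r * phase (evo (φ r) ρ (z r) L) (evo (φ r) (-ρ) (w r) L) ≤
            Real.log ‖w r‖ + η r * phase (z r) (w r) - ε) ∧
          ∀ m ≤ L, ‖evo (φ r) ρ (z r) m‖ ≤ 3 * ‖z r‖ ∧ ‖evo (φ r) (-ρ) (w r) m‖ ≤ 3 * ‖w r‖ := by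
  classical
  obtain ⟨L₁, C₁, D, hC₁, hD, hres⟩ := exists_resonant_pattern φ F hind
  obtain ⟨ρG, hρG⟩ := exists_mean_pattern φ F hind
  obtain ⟨CG, hCG0, hCG⟩ := exists_abs_finsupp_le ρG
  obtain ⟨L₂, hL₂⟩ := Finset.exists_nat_subset_range ρG.support
  choose b hb using hbd
  obtain ⟨B, hB0, hB⟩ : ∃ B : ℝ, 0 ≤ B ∧ ∀ r ∈ F, ∀ m, ‖φ r m‖ ^ 2 ≤ B := by
    refine ⟨∑ r ∈ F, b r ^ 2, by positivity, fun r hr m => ?_⟩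
    refine le_trans ?_ (Finset.single_le_sum (f := fun r => b r ^ 2) (fun _ _ => sq_nonneg _) hr)
    exact pow_le_pow_left₀ (norm_nonneg _) (hb r m) 2
  -- The factor `τ` lets the mean of the non-resonant pattern dominate, for all r at once, the
  -- uncontrolled mean, at most `D`, of the resonant pattern.
  obtain ⟨τ, hτ0, hτ⟩ : ∃ τ : ℝ, 0 ≤ τ ∧ ∀ r ∈ F, 4 * D + 16 ≤ |τ * meanMoment (φ r) ρG| := by
    refine ⟨∑ r ∈ F, (4 * D + 16) / |meanMoment (φ r) ρG|, by positivity, fun r hr => ?_⟩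
    have h0 : 0 < |meanMoment (φ r) ρG| := abs_pos.2 (hρG r hr).2
    have h1 := Finset.single_le_sum (f := fun r => (4 * D + 16) / |meanMoment (φ r) ρG|)
      (fun _ _ => by positivity) hr
    rw [abs_mul, ← div_le_iff₀ h0]
    exact h1.trans (le_abs_self _)
  set L := T * (L₁ + L₂ + 1) with hL
  have hLL : L₁ + L₂ + 1 ≤ L := Nat.le_mul_of_pos_left _ hT
  set C := C₁ + τ * CG with hC
  have hC0 : 0 ≤ C := by positivity
  set C₂ : ℝ := L * (2 * L * (C * B) ^ 2) with hC₂
  have hC₂0 : 0 ≤ C₂ := by positivity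
  have hlyap : ∀ r, ∃ e > 0, r ∈ F → ∀ (ε δ : ℝ) (E h h' : ℂ), 0 < ε → ε ≤ e → |δ| ≤ D →
      ‖E‖ = 1 → h ≠ 0 →
      ‖h - (1 + (ε * ((τ * meanMoment (φ r) ρG : ℝ) + δ) / 2 * Complex.I -
        4 * ε * (1 - conj E)))‖ ≤ C₂ * ε ^ 2 →
      ‖h' - (1 + (ε * ((τ * meanMoment (φ r) ρG : ℝ) + δ) / 2 * Complex.I -
        4 * ε * (1 - conj E)))‖ ≤ C₂ * ε ^ 2 →
      Real.log ‖h‖ + (-2 / (τ * meanMoment (φ r) ρG)) * (E * (h * h' / conj (h * h'))).im ≤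
        (-2 / (τ * meanMoment (φ r) ρG)) * E.im - ε := by
    intro r
    by_cases hr : r ∈ F
    · obtain ⟨e, he, h⟩ := exists_lyapunov_step (τ * meanMoment (φ r) ρG) D C₂ hD hC₂0 (hτ r hr)
      exact ⟨e, he, fun _ => h⟩
    · exact ⟨1, one_pos, fun h => absurd h hr⟩
  choose e he hstep using hlyap
  obtain ⟨ε₁, hε₁, hε₁e⟩ := exists_pos_forall_le F e fun r _ => he r
  refine ⟨L, C, min ε₁ (1 / (L * (C * B) + 1)),
    fun r => if r ∈ F then -2 / (τ * meanMoment (φ r) ρG) else 0, by omega, Dvd.intro _ rfl, hC0,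
    by positivity, fun r => ?_, fun z w hz hw ε hε hεle => ?_⟩
  · dsimp only
    split_ifs with hr
    · rw [abs_div, abs_neg, abs_two]
      exact div_le_one_of_le₀ (by linarith [hτ r hr]) (abs_nonneg _)
    · simp
  obtain ⟨hεa, hεb⟩ := le_min_iff.1 hεle
  rw [le_div_iff₀ (by positivity)] at hεb
  set c : ι → ℂ := fun r => -8 * Complex.I * (z r / conj (z r) - w r / conj (w r)) with hc
  have hc16 : ∀ r, ‖c r‖ ≤ 16 := by
    intro r
    have h1 : ∀ x : ℂ, ‖x / conj x‖ ≤ 1 := fun x => by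
      rw [norm_div, RCLike.norm_conj]; exact div_self_le_one _
    have h2 := norm_sub_le (z r / conj (z r)) (w r / conj (w r))
    rw [hc]
    simp only [norm_mul, norm_neg, Complex.norm_I, Complex.norm_ofNat, mul_one]
    linarith [h1 (z r), h1 (w r)]
  obtain ⟨ρR, hsR, hCR, hmR⟩ := hres c hc16
  set ρ : ℕ →₀ ℝ := ε • (ρR + τ • ρG) with hρ
  have hρC : ∀ m, |ρ m| ≤ C * ε := by
    intro m
    rw [hρ, Finsupp.smul_apply, Finsupp.add_apply, Finsupp.smul_apply, smul_eq_mul, smul_eq_mul,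
      abs_mul, abs_of_pos hε, mul_comm]
    gcongr
    refine (abs_add_le _ _).trans (add_le_add (hCR m) ?_)
    rw [abs_mul, abs_of_nonneg hτ0]
    gcongr
    exact hCG m
  have hsupp : ρ.support ⊆ Finset.range L := by
    refine Finsupp.support_smul.trans (Finsupp.support_add.trans (Finset.union_subset ?_ ?_))
    · exact hsR.trans (Finset.range_subset_range.2 (by omega))
    · exact Finsupp.support_smul.trans (hL₂.trans (Finset.range_subset_range.2 (by omega)))
  have hsmall : L * (C * ε * B) ≤ 1 := by
    nlinarith
  refine ⟨ρ, hρC, fun r hr => ?_⟩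
  have hAr : resMoment (φ r) ρ = ε * (-8 * Complex.I * (z r / conj (z r) - w r / conj (w r))) := by
    rw [hρ, map_smul, map_add, map_smul, (hmR r hr).1, (hρG r hr).1]
    simp [hc]
  have hGr : meanMoment (φ r) ρ = ε * (τ * meanMoment (φ r) ρG + meanMoment (φ r) ρR) := by
    rw [hρ, map_smul, map_add, map_smul, smul_eq_mul, smul_eq_mul]; ring
  obtain ⟨hd1, hd2⟩ := evo_div_sub_le hB0 (hB r hr) (by positivity) hρC hsupp hsmall (hz r) (hw r) hAr
  have hCe : (L : ℝ) * (2 * L * (C * ε * B) ^ 2) = C₂ * ε ^ 2 := by rw [hC₂]; ring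
  have hGc : (meanMoment (φ r) ρ : ℂ) =
      ε * ((τ * meanMoment (φ r) ρG : ℝ) + (meanMoment (φ r) ρR : ℝ)) := by
    rw [hGr]; push_cast; ring
  rw [hCe, hGc] at hd1 hd2
  set z' := evo (φ r) ρ (z r) L with hz'
  set w' := evo (φ r) (-⇑ρ) (w r) L with hw'
  have hz0 : z' ≠ 0 := evo_ne_zero _ _ (hz r) _
  have hw0 : w' ≠ 0 := evo_ne_zero _ _ (hw r) _
  have hE : ‖z r * conj (w r) / (conj (z r) * w r)‖ = 1 := by
    rw [norm_div, norm_mul, norm_mul, RCLike.norm_conj, RCLike.norm_conj]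
    exact div_self (mul_ne_zero (norm_ne_zero_iff.2 (hz r)) (norm_ne_zero_iff.2 (hw r)))
  have hs1 := hstep r hr ε _ _ _ _ hε (hεa.trans (hε₁e r hr)) (hmR r hr).2 hE
    (div_ne_zero hz0 (hz r)) hd1 hd2
  -- Both expansions have the same centre, so the roles of `h` and `h'` may be exchanged.
  have hs2 := hstep r hr ε _ _ _ _ hε (hεa.trans (hε₁e r hr)) (hmR r hr).2 hE
    ((map_ne_zero _).2 (div_ne_zero hw0 (hw r))) hd2 hd1
  rw [mul_comm (conj (w' / w r))] at hs2
  rw [← phase_div_mul (hz r) (hw r), norm_div,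
    Real.log_div (norm_ne_zero_iff.2 hz0) (norm_ne_zero_iff.2 (hz r))] at hs1
  rw [← phase_div_mul (hz r) (hw r), RCLike.norm_conj, norm_div,
    Real.log_div (norm_ne_zero_iff.2 hw0) (norm_ne_zero_iff.2 (hw r))] at hs2
  change _ ≤ _ * phase (z r) (w r) - ε at hs1
  change _ ≤ _ * phase (z r) (w r) - ε at hs2
  simp only [if_pos hr]
  refine ⟨by linarith, by linarith, fun m hm => ⟨?_, ?_⟩⟩
  · exact norm_evo_le _ (by positivity) hB0 (hB r hr) hρC hm hsmall
  · exact norm_evo_le _ (by positivity) hB0 (hB r hr) (by simpa using hρC) hm hsmall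

/-! ### Concatenation of blocks and decay of all states. -/

/-- The values on a block are chosen from the state at its start, which depends only on earlier
values. The approximation `Q k` is already final below `s k`. -/
theorem exists_feedback {S : Type*} (state : (ℕ → ℝ) → ℕ → S)
    (hstate : ∀ q q' n, (∀ k < n, q k = q' k) → state q n = state q' n) {s : ℕ → ℕ}
    (hs : StrictMono s) (c : ℕ → S → ℕ → ℝ) :
    ∃ q : ℕ → ℝ, ∀ k m, s k + m < s (k + 1) → q (s k + m) = c k (state q (s k)) m := by
  let Q : ℕ → ℕ → ℝ := fun k => Nat.rec (fun _ => 0)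
    (fun k Qk n => if n < s k then Qk n else c k (state Qk (s k)) (n - s k)) k
  have hQ : ∀ k n, Q (k + 1) n = if n < s k then Q k n else c k (state (Q k) (s k)) (n - s k) :=
    fun _ _ => rfl
  have hagree : ∀ k d n, n < s k → Q (k + d) n = Q k n := by
    intro k d n hn
    induction d with
    | zero => rfl
    | succ d ih =>
      rw [← add_assoc, hQ, if_pos (hn.trans_le (hs.monotone (by omega))), ih]
  have hq : ∀ k n, n < s k → Q (n + 1) n = Q k n := by
    intro k n hn
    rcases le_total k (n + 1) with h | h
    · obtain ⟨d, hd⟩ := Nat.exists_eq_add_of_le h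
      rw [hd, hagree k d n hn]
    · obtain ⟨d, rfl⟩ := Nat.exists_eq_add_of_le h
      rw [hagree (n + 1) d n (Nat.lt_of_succ_le (hs.id_le (n + 1)))]
  refine ⟨fun n => Q (n + 1) n, fun k m hm => ?_⟩
  dsimp only
  rw [hq (k + 1) _ hm, hQ, if_neg (by omega), Nat.add_sub_cancel_left]
  rw [hstate _ (Q k) (s k) fun n hn => hq k n hn]

theorem exists_mem_block {s : ℕ → ℕ} (hs : StrictMono s) (hs0 : s 0 = 0) (n : ℕ) :
    ∃ k, s k ≤ n ∧ n < s (k + 1) := by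
  induction n with
  | zero => exact ⟨0, hs0.le, (Nat.zero_le _).trans_lt (hs (Nat.lt_succ_self 0))⟩
  | succ n ih =>
    obtain ⟨k, h1, h2⟩ := ih
    rcases Nat.lt_or_ge (n + 1) (s (k + 1)) with h | h
    · exact ⟨k, by omega, h⟩
    · exact ⟨k + 1, h, by have := hs (Nat.lt_succ_self (k + 1)); simp at this; omega⟩

/-- A Lyapunov function that decreases at twice the harmonic rate, up to bounded jumps when the
stage changes, gives decay of order `1 / m` if the stages are long enough. -/
theorem le_div_of_lyapunov {X : ℕ → ℝ} (hX : ∀ m, 0 < X m) {s N : ℕ → ℕ} (hs : StrictMono s)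
    (hs0 : s 0 = 0) (hN : Monotone N) {P : ℕ → ℕ → ℝ} (hP : ∀ N k, |P N k| ≤ 1) {k₀ : ℕ}
    (hk : ∀ k, k₀ ≤ k → 0 < s k ∧ s (k + 1) ≤ 2 * s k ∧ Real.exp (2 * N k + 1) ≤ s k ∧
      Real.log (X (s (k + 1))) + P (N k) (k + 1) ≤
        Real.log (X (s k)) + P (N k) k - 2 * (s (k + 1) - s k) / s k ∧
      ∀ m, s k ≤ m → m < s (k + 1) → X m ≤ 3 * X (s k)) :
    ∃ C, ∀ m : ℕ, X m ≤ C / (m + 1) := by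
  -- The term 2 log s offsets the harmonic decrease, and -2N absorbs the jump of `P`, at most 2,
  -- whenever the stage rises.
  set V : ℕ → ℝ := fun k => Real.log (X (s k)) + P (N k) k + 2 * Real.log (s k) - 2 * N k with hV
  have hanti : ∀ d, V (k₀ + d) ≤ V k₀ := by
    intro d
    induction d with
    | zero => exact le_rfl
    | succ d ih =>
      refine le_trans ?_ ih
      rw [← add_assoc]
      obtain ⟨h1, h2, h3, h4, h5⟩ := hk (k₀ + d) (by omega)
      generalize k₀ + d = k at *
      have hsk : (0 : ℝ) < s k := by exact_mod_cast h1
      have hsk' : (0 : ℝ) < s (k + 1) := by exact_mod_cast h1.trans (hs (Nat.lt_succ_self k))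
      have hlog : Real.log (s (k + 1)) - Real.log (s k) ≤ (s (k + 1) - s k) / s k := by
        rw [← Real.log_div hsk'.ne' hsk.ne', sub_div, div_self hsk.ne']
        exact Real.log_le_sub_one_of_pos (by positivity)
      have hjump : P (N (k + 1)) (k + 1) - 2 * N (k + 1) ≤ P (N k) (k + 1) - 2 * N k := by
        rcases (hN (Nat.le_succ k)).eq_or_lt with h | h
        · rw [show N (k + 1) = N k from h.symm]
        · have h6 := (abs_le.1 (hP (N (k + 1)) (k + 1))).2
          have h7 := (abs_le.1 (hP (N k) (k + 1))).1
          have h8 : (N k : ℝ) + 1 ≤ N (k + 1) := by exact_mod_cast h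
          linarith
      have e : 2 * ((s (k + 1) : ℝ) - s k) / s k = 2 * ((s (k + 1) - s k) / s k) := by ring
      rw [e] at h4
      change Real.log (X (s (k + 1))) + P (N (k + 1)) (k + 1) + 2 * Real.log (s (k + 1))
        - 2 * N (k + 1) ≤ Real.log (X (s k)) + P (N k) k + 2 * Real.log (s k) - 2 * N k
      linarith
  -- The 6 is the growth 3 inside a block times 2 from m + 1 ≤ 2 s_k; the sum covers the times
  -- before `s k₀`.
  refine ⟨6 * Real.exp (V k₀) + ∑ j ∈ Finset.range (s k₀), X j * (j + 1), fun m => ?_⟩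
  rw [le_div_iff₀ (by positivity)]
  have hsum : 0 ≤ ∑ j ∈ Finset.range (s k₀), X j * ((j : ℝ) + 1) :=
    Finset.sum_nonneg fun j _ => mul_nonneg (hX j).le (by positivity)
  rcases lt_or_ge m (s k₀) with hm | hm
  · have := Finset.single_le_sum (f := fun j : ℕ => X j * ((j : ℝ) + 1))
      (fun j _ => mul_nonneg (hX j).le (by positivity)) (Finset.mem_range.2 hm)
    have := Real.exp_pos (V k₀)
    linarith
  · obtain ⟨k, hk1, hk2⟩ := exists_mem_block hs hs0 m
    have hkk : k₀ ≤ k := by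
      by_contra h
      exact absurd (hs.monotone (show k + 1 ≤ k₀ by omega)) (by omega)
    obtain ⟨d, rfl⟩ := Nat.exists_eq_add_of_le hkk
    have ha := hanti d
    obtain ⟨h1, h2, h3, h4, h5⟩ := hk (k₀ + d) hkk
    generalize k₀ + d = k at *
    have hsk : (0 : ℝ) < s k := by exact_mod_cast h1
    have h6 := h5 m hk1 hk2
    have h7 := (abs_le.1 (hP (N k) k)).1
    have h8 : X (s k) * s k ^ 2 ≤ Real.exp (V k₀) * Real.exp (2 * N k + 1) := by
      rw [← Real.exp_add]
      rw [← Real.exp_log (mul_pos (hX (s k)) (pow_pos hsk 2)), Real.exp_le_exp,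
        Real.log_mul (hX _).ne' (by positivity), Real.log_pow]
      change Real.log (X (s k)) + P (N k) k + 2 * Real.log (s k) - 2 * N k ≤ _ at ha
      push_cast
      linarith
    -- The stage length exp(2N + 1) ≤ s_k consumes one of the two powers of s_k.
    have h9 : X (s k) * s k ≤ Real.exp (V k₀) := by
      have : X (s k) * s k * s k ≤ Real.exp (V k₀) * s k := by
        calc _ = X (s k) * s k ^ 2 := by ring
          _ ≤ _ := h8.trans (by gcongr)
      exact le_of_mul_le_mul_right this hsk
    have h10 : (m : ℝ) + 1 ≤ 2 * s k := by exact_mod_cast (by omega : m + 1 ≤ 2 * s k)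
    calc X m * (m + 1) ≤ 3 * X (s k) * (2 * s k) := by
          gcongr
          exact mul_nonneg (by norm_num) (hX _).le
      _ = 6 * (X (s k) * s k) := by ring
      _ ≤ _ := by linarith

theorem apply_add_mul_of_quasiperiodic {φ : ℕ → ℂ} {μ : ℂ} {T : ℕ}
    (h : ∀ m, φ (m + T) = μ * φ m) (k m : ℕ) : φ (T * k + m) = μ ^ k * φ m := by
  induction k with
  | zero => simp
  | succ k ih =>
    rw [show T * (k + 1) + m = (T * k + m) + T by ring, h, ih, pow_succ]; ring

theorem exists_norm_le_of_quasiperiodic {φ : ℕ → ℂ} {μ : ℂ} (hμ : ‖μ‖ = 1) {T : ℕ} (hT : 0 < T)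
    (h : ∀ m, φ (m + T) = μ * φ m) : ∃ B, ∀ m, ‖φ m‖ ≤ B := by
  refine ⟨∑ j ∈ Finset.range T, ‖φ j‖, fun m => ?_⟩
  rw [← Nat.div_add_mod m T, apply_add_mul_of_quasiperiodic h, norm_mul, norm_pow, hμ, one_pow,
    one_mul]
  exact Finset.single_le_sum (f := fun j => ‖φ j‖) (fun _ _ => norm_nonneg _)
    (Finset.mem_range.2 (Nat.mod_lt _ hT))

theorem evo_rotate_left (φ : ℕ → ℂ) (ρ : ℕ → ℝ) (z : ℂ) {ν : ℂ} (hν : ‖ν‖ = 1) (m : ℕ) :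
    evo (fun k => ν * φ k) ρ z m = ν⁻¹ * evo φ ρ (ν * z) m := by
  have h0 : ν ≠ 0 := by
    rintro rfl
    simp at hν
  rw [← evo_rotate φ ρ z hν, inv_mul_cancel_left₀ h0]

/-- The block lemma, for blocks that start at an arbitrary multiple of the period. -/
theorem exists_block_at {ι : Type*} (φ : ι → ℕ → ℂ)
    (hind : ∀ r₀, LinearIndependent ℂ (resonance φ r₀)) {T : ℕ} (hT : 0 < T) {μ : ι → ℂ}
    (hμ : ∀ r, ‖μ r‖ = 1) (hper : ∀ r m, φ r (m + T) = μ r * φ r m) (F : Finset ι) :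
    ∃ (L : ℕ) (C ε₀ : ℝ) (η : ι → ℝ), 0 < L ∧ T ∣ L ∧ 0 ≤ C ∧ 0 < ε₀ ∧ (∀ r, |η r| ≤ 1) ∧
      ∀ s, T ∣ s → ∀ z w : ι → ℂ, (∀ r, z r ≠ 0) → (∀ r, w r ≠ 0) → ∀ ε, 0 < ε → ε ≤ ε₀ →
        ∃ ρ : ℕ → ℝ, (∀ m, |ρ m| ≤ C * ε) ∧ ∀ r ∈ F, ∀ z' w' : ℕ → ℂ,
          z' = evo (fun k => φ r (s + k)) ρ (z r) → w' = evo (fun k => φ r (s + k)) (-ρ) (w r) →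
          Real.log ‖z' L‖ + η r * phase (z' L) (w' L) ≤
            Real.log ‖z r‖ + η r * phase (z r) (w r) - ε ∧
          Real.log ‖w' L‖ + η r * phase (z' L) (w' L) ≤
            Real.log ‖w r‖ + η r * phase (z r) (w r) - ε ∧
          ∀ m ≤ L, ‖z' m‖ ≤ 3 * ‖z r‖ ∧ ‖w' m‖ ≤ 3 * ‖w r‖ := by
  obtain ⟨L, C, ε₀, η, h1, h2, h3, h4, h5, h6⟩ := exists_block φ hind
    (fun r => exists_norm_le_of_quasiperiodic (hμ r) hT (hper r)) F hT
  refine ⟨L, C, ε₀, η, h1, h2, h3, h4, h5, ?_⟩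
  rintro s ⟨j, rfl⟩ z w hz hw ε hε hεle
  have hν : ∀ r, ‖μ r ^ j‖ = 1 := fun r => by rw [norm_pow, hμ, one_pow]
  have hν0 : ∀ r, μ r ^ j ≠ 0 := fun r h => by have := hν r; rw [h] at this; simp at this
  obtain ⟨ρ, hρ, hF⟩ := h6 (fun r => μ r ^ j * z r) (fun r => μ r ^ j * w r)
    (fun r => mul_ne_zero (hν0 r) (hz r)) (fun r => mul_ne_zero (hν0 r) (hw r)) ε hε hεle
  refine ⟨ρ, hρ, fun r hr z' w' hz' hw' => ?_⟩
  -- After j periods φ is multiplied by the unimodular μ^j. Moving this factor into the states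
  -- changes neither norms nor phase differences.
  have hφ : (fun k => φ r (T * j + k)) = fun k => μ r ^ j * φ r k :=
    funext fun k => apply_add_mul_of_quasiperiodic (hper r) j k
  have hinv : ‖(μ r ^ j)⁻¹‖ = 1 := by rw [norm_inv, hν, inv_one]
  have hzm : ∀ m, z' m = (μ r ^ j)⁻¹ * evo (φ r) ρ (μ r ^ j * z r) m := fun m => by
    rw [hz', hφ, evo_rotate_left _ _ _ (hν r)]
  have hwm : ∀ m, w' m = (μ r ^ j)⁻¹ * evo (φ r) (-ρ) (μ r ^ j * w r) m := fun m => by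
    rw [hw', hφ, evo_rotate_left _ _ _ (hν r)]
  have h7 := hF r hr
  simp only [norm_mul, hν, one_mul, phase_rotate _ _ (hν r)] at h7
  simp only [hzm, hwm, norm_mul, hinv, one_mul, phase_rotate _ _ hinv]
  exact h7

/-- There is a perturbation, barely larger than `1 / m`, under which all states decay at least
like `1 / m`. -/
theorem exists_decaying {ι : Type*} [Countable ι] (φ : ι → ℕ → ℂ)
    (hind : ∀ r₀, LinearIndependent ℂ (resonance φ r₀)) {T : ℕ} (hT : 0 < T) {μ : ι → ℂ}
    (hμ : ∀ r, ‖μ r‖ = 1) (hper : ∀ r m, φ r (m + T) = μ r * φ r m) {z₀ w₀ : ι → ℂ}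
    (hz₀ : ∀ r, z₀ r ≠ 0) (hw₀ : ∀ r, w₀ r ≠ 0) {κ : ℕ → ℝ} (hκ0 : ∀ m, 0 < κ m)
    (hκ : Tendsto κ atTop atTop) :
    ∃ ρ : ℕ → ℝ, (∀ m : ℕ, |ρ m| ≤ κ m / (m + 1)) ∧ ∀ r,
      (∃ C, ∀ m : ℕ, ‖evo (φ r) ρ (z₀ r) m‖ ≤ C / (m + 1)) ∧
      ∃ C, ∀ m : ℕ, ‖evo (φ r) (-ρ) (w₀ r) m‖ ≤ C / (m + 1) := by
  classical
  obtain ⟨e, he⟩ := Countable.exists_injective_nat ι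
  have hFin : ∀ N : ℕ, (e ⁻¹' (Finset.range N : Set ℕ)).Finite := fun N =>
    (Finset.finite_toSet _).preimage he.injOn
  choose L C ε₀ η hL0 hLT hC0 hε₀ hη hblock using fun N =>
    exists_block_at φ hind hT hμ hper (hFin N).toFinset
  -- Stage N is affordable from time n on if ε = 2L/n is admissible, a block at most doubles the
  -- time, the size constant 4CL is below κ, and n outweighs the jumps.
  have hthr : ∀ N, ∃ n₀ : ℕ, ∀ n : ℕ, n₀ ≤ n → 2 * (L N : ℝ) / n ≤ ε₀ N ∧ L N < n ∧
      4 * C N * L N ≤ κ n ∧ Real.exp (2 * N + 1) ≤ n := by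
    intro N
    rw [← eventually_atTop]
    have h1 := (tendsto_const_div_atTop_nhds_zero_nat (2 * (L N : ℝ))).eventually_le_const (hε₀ N)
    filter_upwards [h1, eventually_gt_atTop (L N), hκ.eventually_ge_atTop (4 * C N * L N),
      tendsto_natCast_atTop_atTop.eventually_ge_atTop (Real.exp (2 * N + 1))] with n a b c d
    exact ⟨a, b, c, d⟩
  choose thr hthr using hthr
  -- This is monotone even if `thr` is not. The value 0 is also the default when nothing is
  -- affordable; the perturbation is then zero.
  set stage : ℕ → ℕ := fun n => Nat.findGreatest (fun N => thr N ≤ n) n with hstage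
  have hstage_thr : ∀ n, stage n ≠ 0 → thr (stage n) ≤ n := fun n hn =>
    Nat.findGreatest_of_ne_zero (P := fun N => thr N ≤ n) rfl hn
  have hstage_mono : Monotone stage := fun n n' hn =>
    Nat.findGreatest_mono (fun N (hN : thr N ≤ n) => hN.trans hn) hn
  have hstage_le : ∀ N n, N ≤ n → thr N ≤ n → N ≤ stage n := fun N n h1 h2 =>
    Nat.le_findGreatest h1 h2
  obtain ⟨s, hs0, hs1⟩ : ∃ s : ℕ → ℕ, s 0 = 0 ∧ ∀ k, s (k + 1) = s k + L (stage (s k)) :=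
    ⟨fun k => Nat.rec 0 (fun _ n => n + L (stage n)) k, rfl, fun _ => rfl⟩
  have hs : StrictMono s := strictMono_nat_of_lt_succ fun k => by
    rw [hs1]; exact Nat.lt_add_of_pos_right (hL0 _)
  have hsT : ∀ k, T ∣ s k := by
    intro k
    induction k with
    | zero => rw [hs0]; exact dvd_zero T
    | succ k ih => rw [hs1]; exact dvd_add ih (hLT _)
  have hchoice : ∀ (k : ℕ) (x : (ι → ℂ) × (ι → ℂ)), ∃ ρ : ℕ → ℝ,
      (stage (s k) = 0 → ρ = 0) ∧
      (stage (s k) ≠ 0 → (∀ m, |ρ m| ≤ C (stage (s k)) * (2 * L (stage (s k)) / s k)) ∧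
        ((∀ r, x.1 r ≠ 0) → (∀ r, x.2 r ≠ 0) → ∀ r, e r < stage (s k) → ∀ z' w' : ℕ → ℂ,
          z' = evo (fun j => φ r (s k + j)) ρ (x.1 r) →
          w' = evo (fun j => φ r (s k + j)) (-ρ) (x.2 r) →
          Real.log ‖z' (L (stage (s k)))‖ +
              η (stage (s k)) r * phase (z' (L (stage (s k)))) (w' (L (stage (s k)))) ≤
            Real.log ‖x.1 r‖ + η (stage (s k)) r * phase (x.1 r) (x.2 r)
              - 2 * L (stage (s k)) / (s k : ℝ) ∧
          Real.log ‖w' (L (stage (s k)))‖ +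
              η (stage (s k)) r * phase (z' (L (stage (s k)))) (w' (L (stage (s k)))) ≤
            Real.log ‖x.2 r‖ + η (stage (s k)) r * phase (x.1 r) (x.2 r)
              - 2 * L (stage (s k)) / (s k : ℝ) ∧
          ∀ m ≤ L (stage (s k)), ‖z' m‖ ≤ 3 * ‖x.1 r‖ ∧ ‖w' m‖ ≤ 3 * ‖x.2 r‖)) := by
    intro k x
    by_cases h0 : stage (s k) = 0
    · exact ⟨0, fun _ => rfl, fun h => absurd h0 h⟩
    obtain ⟨h1, h2, -, -⟩ := hthr _ _ (hstage_thr _ h0)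
    have hpos : (0 : ℝ) < 2 * L (stage (s k)) / s k := by
      have := hL0 (stage (s k))
      have : 0 < s k := by omega
      positivity
    by_cases hx : (∀ r, x.1 r ≠ 0) ∧ ∀ r, x.2 r ≠ 0
    · obtain ⟨ρ, hρ, hρF⟩ := hblock _ _ (hsT k) x.1 x.2 hx.1 hx.2 _ hpos h1
      refine ⟨ρ, fun h => absurd h h0, fun _ => ⟨hρ, fun _ _ r hr => hρF r ?_⟩⟩
      simpa using hr
    -- A filler: actual states never vanish.
    · refine ⟨0, fun _ => rfl, fun _ => ⟨fun m => ?_, fun ha hb => absurd ⟨ha, hb⟩ hx⟩⟩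
      simp only [Pi.zero_apply, abs_zero]
      exact mul_nonneg (hC0 _) hpos.le
  choose c hc0 hc using hchoice
  obtain ⟨q, hq⟩ := exists_feedback
    (fun q n => ((fun r => evo (φ r) q (z₀ r) n, fun r => evo (φ r) (-q) (w₀ r) n) :
      (ι → ℂ) × (ι → ℂ)))
    (fun q q' n h => Prod.ext (funext fun r => evo_congr _ _ h)
      (funext fun r => evo_congr _ _ fun k hk => by simp [h k hk])) hs c
  set x : ℕ → (ι → ℂ) × (ι → ℂ) := fun k =>
    (fun r => evo (φ r) q (z₀ r) (s k), fun r => evo (φ r) (-q) (w₀ r) (s k)) with hx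
  refine ⟨q, fun n => ?_, fun r => ?_⟩
  · obtain ⟨k, hk1, hk2⟩ := exists_mem_block hs hs0 n
    obtain ⟨m, rfl⟩ := Nat.exists_eq_add_of_le hk1
    rw [hq k m hk2]
    by_cases h0 : stage (s k) = 0
    · rw [hc0 _ _ h0]
      simp only [Pi.zero_apply, abs_zero]
      exact div_nonneg (hκ0 _).le (by positivity)
    · have ht := hstage_thr _ h0
      obtain ⟨-, h2, -, -⟩ := hthr _ _ ht
      obtain ⟨-, -, h3, -⟩ := hthr _ _ (ht.trans (Nat.le_add_right (s k) m))
      refine ((hc _ _ h0).1 m).trans ?_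
      have hsk : (0 : ℝ) < s k := by exact_mod_cast (by omega : 0 < s k)
      rw [hs1] at hk2
      have h4 : ((s k + m : ℕ) : ℝ) + 1 ≤ 2 * s k := by
        exact_mod_cast (by omega : s k + m + 1 ≤ 2 * s k)
      rw [le_div_iff₀ (by positivity)]
      have h5 : 0 ≤ C (stage (s k)) * (2 * L (stage (s k)) / s k) :=
        mul_nonneg (hC0 _) (by positivity)
      calc _ ≤ C (stage (s k)) * (2 * L (stage (s k)) / s k) * (2 * s k) := by gcongr
        _ = 4 * C (stage (s k)) * L (stage (s k)) := by field_simp; ring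
        _ ≤ _ := h3
  · obtain ⟨k₀, hk₀⟩ : ∃ k₀, ∀ k, k₀ ≤ k → e r < stage (s k) := by
      refine ⟨max (e r + 1) (thr (e r + 1)), fun k hk => ?_⟩
      have h1 : k ≤ s k := hs.id_le k
      exact hstage_le (e r + 1) _ (by omega) (by omega)
    have hblk : ∀ k m, m ≤ L (stage (s k)) →
        evo (φ r) q (z₀ r) (s k + m) =
          evo (fun j => φ r (s k + j)) (c k (x k)) ((x k).1 r) m ∧
        evo (φ r) (-q) (w₀ r) (s k + m) =
          evo (fun j => φ r (s k + j)) (-c k (x k)) ((x k).2 r) m := by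
      intro k m hm
      rw [evo_add, evo_add]
      have h1 : ∀ j < m, q (s k + j) = c k (x k) j := fun j hj =>
        hq k j (by rw [hs1]; omega)
      exact ⟨evo_congr _ _ h1, evo_congr _ _ fun j hj => by simp [h1 j hj]⟩
    have hmain : ∀ k, k₀ ≤ k → _ := fun k hk =>
      (hc k (x k) (by have := hk₀ k hk; omega)).2 (fun r => evo_ne_zero _ _ (hz₀ r) _)
        (fun r => evo_ne_zero _ _ (hw₀ r) _) r (hk₀ k hk) _ _ rfl rfl
    have hP : ∀ N k, |η N r * phase ((x k).1 r) ((x k).2 r)| ≤ 1 := fun N k => by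
      rw [abs_mul]
      exact mul_le_one₀ (hη N r) (abs_nonneg _) (abs_phase_le _ _)
    have hgen : ∀ k, k₀ ≤ k → 0 < s k ∧ s (k + 1) ≤ 2 * s k ∧
        Real.exp (2 * stage (s k) + 1) ≤ s k ∧
        (L (stage (s k)) : ℝ) = s (k + 1) - s k := by
      intro k hk
      obtain ⟨-, h2, -, h4⟩ := hthr _ _ (hstage_thr (s k) (by have := hk₀ k hk; omega))
      refine ⟨by omega, by rw [hs1]; omega, h4, ?_⟩
      rw [hs1]; push_cast; ring
    constructor
    · refine le_div_of_lyapunov (X := fun m => ‖evo (φ r) q (z₀ r) m‖)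
        (fun m => norm_pos_iff.2 (evo_ne_zero _ _ (hz₀ r) _)) hs hs0
        (hstage_mono.comp hs.monotone) hP (k₀ := k₀) fun k hk => ?_
      obtain ⟨h1, h2, h3, h4⟩ := hgen k hk
      obtain ⟨h5, -, h7⟩ := hmain k hk
      refine ⟨h1, h2, h3, ?_, fun m hm1 hm2 => ?_⟩
      · rw [← (hblk k _ le_rfl).1, ← (hblk k _ le_rfl).2, h4, ← hs1] at h5
        exact h5
      · obtain ⟨j, rfl⟩ := Nat.exists_eq_add_of_le hm1
        rw [hs1] at hm2
        rw [(hblk k j (by omega)).1]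
        exact (h7 j (by omega)).1
    · refine le_div_of_lyapunov (X := fun m => ‖evo (φ r) (-q) (w₀ r) m‖)
        (fun m => norm_pos_iff.2 (evo_ne_zero _ _ (hw₀ r) _)) hs hs0
        (hstage_mono.comp hs.monotone) hP (k₀ := k₀) fun k hk => ?_
      obtain ⟨h1, h2, h3, h4⟩ := hgen k hk
      obtain ⟨-, h5, h7⟩ := hmain k hk
      refine ⟨h1, h2, h3, ?_, fun m hm1 hm2 => ?_⟩
      · rw [← (hblk k _ le_rfl).1, ← (hblk k _ le_rfl).2, h4, ← hs1] at h5
        exact h5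
      · obtain ⟨j, rfl⟩ := Nat.exists_eq_add_of_le hm1
        rw [hs1] at hm2
        rw [(hblk k j (by omega)).2]
        exact (h7 j (by omega)).2

/-! ### Bloch solutions. -/

/-- A normalised Bloch solution of the unperturbed equation. -/
structure IsBloch (T : ℕ) (a b : ℕ → ℝ) (l : ℝ) (μ : ℂ) (ψ : ℕ → ℂ) : Prop where
  norm_mult : ‖μ‖ = 1
  re_mult : μ.re = Real.cos (quasiMomentum T a b l)
  quasiperiodic : ∀ n, ψ (n + T) = μ * ψ n
  equation : ∀ n, a n * ψ n + b (n + 1) * ψ (n + 1) + a (n + 1) * ψ (n + 2) = l * ψ (n + 1)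
  wronskian : ∀ n, a n * (conj (ψ n) * ψ (n + 1)).im = 1

theorem transferProd_succ_zero (a b : ℕ → ℝ) (l : ℝ) (n : ℕ) (j : Fin 2) :
    transferProd a b l (n + 1) 0 j = transferProd a b l n 1 j := by
  simp [transferProd, transferMatrix, Matrix.mul_apply, Fin.sum_univ_two]

theorem transferProd_succ_one (a b : ℕ → ℝ) (l : ℝ) (n : ℕ) (j : Fin 2) :
    transferProd a b l (n + 1) 1 j =
      -(a n / a (n + 1)) * transferProd a b l n 0 j +
        (l - b (n + 1)) / a (n + 1) * transferProd a b l n 1 j := by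
  simp [transferProd, transferMatrix, Matrix.mul_apply, Fin.sum_univ_two]

theorem transferProd_add_period {T : ℕ} {a b : ℕ → ℝ} (haT : Function.Periodic a T)
    (hbT : Function.Periodic b T) (l : ℝ) (n : ℕ) :
    transferProd a b l (n + T) = transferProd a b l n * monodromy T a b l := by
  induction n with
  | zero => simp [transferProd, monodromy]
  | succ n ih =>
    have h : transferMatrix a b l (n + T + 1) = transferMatrix a b l (n + 1) := by
      rw [transferMatrix, transferMatrix, Nat.add_sub_cancel, Nat.add_sub_cancel, haT n,
        show n + T + 1 = n + 1 + T by ring, haT (n + 1), hbT (n + 1)]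
    rw [show n + 1 + T = n + T + 1 by ring, transferProd, h, ih, transferProd, Matrix.mul_assoc]

/-- Transfer matrices propagate an eigenvector of the monodromy matrix. The Wronskian is det
`transferProd` times its initial value, hence constant after multiplication by `a n`. -/
theorem exists_isBloch {T : ℕ} {a b : ℕ → ℝ} (ha : ∀ i, 0 < a i)
    (haT : Function.Periodic a T) (hbT : Function.Periodic b T) {l : ℝ}
    (hl : l ∈ sigmaEll T a b) : ∃ μ ψ, IsBloch T a b l μ ψ := by
  have htr := abs_lt.1 (show |(monodromy T a b l).trace| < 2 from hl)
  have hdet := det_monodromy b l ha haT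
  have hper := transferProd_add_period haT hbT l
  have hcos : Real.cos (quasiMomentum T a b l) = (monodromy T a b l).trace / 2 :=
    Real.cos_arccos (by linarith) (by linarith)
  generalize monodromy T a b l = M at *
  rw [Matrix.trace_fin_two] at htr hcos
  rw [Matrix.det_fin_two] at hdet
  obtain ⟨x, hx⟩ : ∃ x, x = (M 0 0 + M 1 1) / 2 := ⟨_, rfl⟩
  -- Otherwise M₀₀ M₁₁ = 1, which forces |Tr M| ≥ 2.
  have hM01 : M 0 1 ≠ 0 := by
    intro h
    rw [h] at hdet
    nlinarith [sq_nonneg (M 0 0 - M 1 1)]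
  have hx1 : 0 < 1 - x ^ 2 := by rw [hx]; nlinarith
  -- The sign of Im μ is dictated by positivity of the Wronskian, which `t` then scales to 1. So μ
  -- may be exp(iθ) or exp(-iθ), and only its real part is recorded.
  obtain ⟨y, hy, hyM⟩ : ∃ y, y ^ 2 = 1 - x ^ 2 ∧ 0 < M 0 1 * y := by
    rcases lt_or_gt_of_ne hM01 with h | h
    · exact ⟨-√(1 - x ^ 2), by rw [neg_sq, Real.sq_sqrt hx1.le],
        mul_pos_of_neg_of_neg h (neg_lt_zero.2 (Real.sqrt_pos.2 hx1))⟩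
    · exact ⟨√(1 - x ^ 2), Real.sq_sqrt hx1.le, mul_pos h (Real.sqrt_pos.2 hx1)⟩
  obtain ⟨t, ht⟩ : ∃ t, a 0 * t ^ 2 * (M 0 1 * y) = 1 := by
    have h0 := ha 0
    refine ⟨√(1 / (a 0 * (M 0 1 * y))), ?_⟩
    rw [Real.sq_sqrt (by positivity)]
    generalize M 0 1 * y = w at hyM
    field_simp
  set μ : ℂ := x + y * Complex.I with hμ
  have hyC : (y : ℂ) ^ 2 = 1 - x ^ 2 := by exact_mod_cast hy
  have hxC : (2 : ℂ) * x = M 0 0 + M 1 1 := by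
    have : 2 * x = M 0 0 + M 1 1 := by rw [hx]; ring
    exact_mod_cast this
  have hdetC : (M 0 0 : ℂ) * M 1 1 - M 0 1 * M 1 0 = 1 := by exact_mod_cast hdet
  have hchar : μ ^ 2 = 2 * x * μ - 1 := by
    rw [hμ]
    linear_combination (-1 : ℂ) * hyC + y ^ 2 * Complex.I_sq
  set v0 : ℂ := -M 0 1 * t with hv0
  set v1 : ℂ := (M 0 0 - μ) * t with hv1
  have hMv0 : M 0 0 * v0 + M 0 1 * v1 = μ * v0 := by rw [hv0, hv1]; ring
  have hMv1 : M 1 0 * v0 + M 1 1 * v1 = μ * v1 := by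
    rw [hv0, hv1]
    linear_combination (t : ℂ) * (hdetC + hchar) + (t * μ) * hxC
  set P := transferProd a b l with hP
  have hsucc : ∀ n (j : Fin 2), P (n + 1) 0 j = P n 1 j := transferProd_succ_zero a b l
  refine ⟨μ, fun n => P n 0 0 * v0 + P n 0 1 * v1, ?_, ?_, fun n => ?_, fun n => ?_, fun n => ?_⟩
  · have : ‖μ‖ ^ 2 = 1 := by
      rw [← Complex.normSq_eq_norm_sq, hμ, Complex.normSq_add_mul_I, hy]; ring
    exact (pow_eq_one_iff_of_nonneg (norm_nonneg μ) two_ne_zero).1 this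
  · rw [hcos, hμ]
    simp [hx]
  · rw [hper n, Matrix.mul_apply, Matrix.mul_apply, Fin.sum_univ_two, Fin.sum_univ_two]
    push_cast
    linear_combination (P n 0 0 : ℂ) * hMv0 + (P n 0 1 : ℂ) * hMv1
  · have h1 : ∀ j : Fin 2, (a (n + 1) : ℂ) * P (n + 2) 0 j =
        -a n * P n 0 j + (l - b (n + 1)) * P (n + 1) 0 j := by
      intro j
      have h2 : a (n + 1) * P (n + 2) 0 j = -a n * P n 0 j + (l - b (n + 1)) * P (n + 1) 0 j := by
        have := (ha (n + 1)).ne'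
        rw [hsucc (n + 1), hsucc n, hP, transferProd_succ_one]
        field_simp
      exact_mod_cast h2
    linear_combination v0 * h1 0 + v1 * h1 1
  · have hd : a n * (P n 0 0 * P n 1 1 - P n 0 1 * P n 1 0) = a 0 := by
      have := det_transferProd b l ha n
      rw [Matrix.det_fin_two] at this
      rw [hP, this, mul_div_cancel₀ _ (ha n).ne']
    rw [hsucc, hsucc]
    have e : (conj ((P n 0 0 : ℂ) * v0 + P n 0 1 * v1) * (P n 1 0 * v0 + P n 1 1 * v1)).im =
        (P n 0 0 * P n 1 1 - P n 0 1 * P n 1 0) * (t ^ 2 * (M 0 1 * y)) := by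
      rw [hv0, hv1, hμ]
      simp [Complex.mul_im, Complex.mul_re]
      ring
    rw [e, ← mul_assoc, hd, ← mul_assoc, ht]

/-! ### Linear independence of the squared Bloch solutions. -/

/-- Proportional squares mean φ_n = ±d χ_n. Constancy of both Wronskians makes the product τ of
consecutive signs constant, and the recurrences give l - b = τ (l' - b): τ = 1 and τ = -1 are the
two alternatives. -/
theorem eq_or_forall_of_sq_eq {a b : ℕ → ℝ} {l l' w w' : ℝ} {φ χ : ℕ → ℂ}
    (hφ : ∀ n, a n * φ n + b (n + 1) * φ (n + 1) + a (n + 1) * φ (n + 2) = l * φ (n + 1))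
    (hχ : ∀ n, a n * χ n + b (n + 1) * χ (n + 1) + a (n + 1) * χ (n + 2) = l' * χ (n + 1))
    (hw : w ≠ 0) (hφw : ∀ n, a n * (conj (φ n) * φ (n + 1)).im = w)
    (hχw : ∀ n, a n * (conj (χ n) * χ (n + 1)).im = w') {c : ℂ}
    (hc : ∀ n, φ n ^ 2 = c * χ n ^ 2) : l = l' ∨ ∀ n, 2 * b (n + 1) = l + l' := by
  have hφ0 : ∀ n, φ n ≠ 0 := fun n h => hw (by rw [← hφw n, h]; simp)
  obtain ⟨d, hd⟩ := IsAlgClosed.exists_pow_nat_eq c (n := 2) (by norm_num)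
  have hε : ∀ n, ∃ ε : ℝ, ε ^ 2 = 1 ∧ φ n = ε * (d * χ n) := by
    intro n
    have h1 : φ n ^ 2 = (d * χ n) ^ 2 := by rw [hc, mul_pow, hd]
    rcases sq_eq_sq_iff_eq_or_eq_neg.1 h1 with h | h
    · exact ⟨1, by norm_num, by simpa using h⟩
    · exact ⟨-1, by norm_num, by simpa using h⟩
  choose ε hε1 hεφ using hε
  have hdχ : ∀ n, d * χ n ≠ 0 := fun n h => hφ0 n (by rw [hεφ, h, mul_zero])
  have hprod : ∀ n, ε n * ε (n + 1) * (‖d‖ ^ 2 * w') = w := by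
    intro n
    rw [← hφw n, hεφ n, hεφ (n + 1), ← hχw n]
    have e : conj ((ε n : ℂ) * (d * χ n)) * (ε (n + 1) * (d * χ (n + 1))) =
        ((ε n * ε (n + 1) * ‖d‖ ^ 2 : ℝ) : ℂ) * (conj (χ n) * χ (n + 1)) := by
      have h1 : ((‖d‖ ^ 2 : ℝ) : ℂ) = d * conj d := by
        rw [Complex.mul_conj, Complex.normSq_eq_norm_sq]
      rw [Complex.ofReal_mul, h1]
      simp only [map_mul, Complex.conj_ofReal, Complex.ofReal_mul]
      ring
    rw [e, Complex.im_ofReal_mul]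
    ring
  have hne : ‖d‖ ^ 2 * w' ≠ 0 := fun h => hw (by rw [← hprod 0, h, mul_zero])
  have hτ : ∀ n, ε n * ε (n + 1) = ε 0 * ε 1 := fun n =>
    mul_right_cancel₀ hne ((hprod n).trans (hprod 0).symm)
  have hτ1 : (ε 0 * ε 1) ^ 2 = 1 := by rw [mul_pow, hε1, hε1, one_mul]
  have hkey : ∀ n, l - b (n + 1) = ε 0 * ε 1 * (l' - b (n + 1)) := by
    intro n
    have h1 : ε n = ε 0 * ε 1 * ε (n + 1) := by
      rw [← hτ n, mul_assoc, ← sq, hε1, mul_one]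
    have h2 : ε (n + 2) = ε 0 * ε 1 * ε (n + 1) := by
      rw [← hτ (n + 1), mul_comm, ← mul_assoc, ← sq, hε1, one_mul]
    have h3 := hφ n
    rw [hεφ n, hεφ (n + 1), hεφ (n + 2), h1, h2] at h3
    have h4 := hχ n
    have h5 : ((ε (n + 1) : ℂ) * (d * χ (n + 1))) * (l - b (n + 1)) =
        (ε (n + 1) * (d * χ (n + 1))) * (ε 0 * ε 1 * (l' - b (n + 1))) := by
      push_cast at h3
      linear_combination (-1 : ℂ) * h3 + ε 0 * ε 1 * ε (n + 1) * d * h4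
    rw [← hεφ] at h5
    exact_mod_cast mul_left_cancel₀ (hφ0 _) h5
  rcases mul_self_eq_one_iff.1 ((sq _).symm.trans hτ1) with h | h
  · left
    have := hkey 0
    rw [h] at this
    linarith
  · right
    intro n
    have := hkey n
    rw [h] at this
    linarith

/-- Eigenspaces are independent, and each contains at most two of the vectors, which are not
proportional. -/
theorem linearIndependent_of_eigenvectors {V κ : Type*} [AddCommGroup V] [Module ℂ V]
    (S : Module.End ℂ V) {v : κ → V} {ν : κ → ℂ} (hv : ∀ k, S (v k) = ν k • v k)
    (h0 : ∀ k, v k ≠ 0) (h2 : ∀ k l, k ≠ l → ν k = ν l → ∀ c : ℂ, v k ≠ c • v l)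
    (h3 : ∀ k l m, ν k = ν l → ν l = ν m → k = l ∨ l = m ∨ k = m) :
    LinearIndependent ℂ v := by
  classical
  rw [linearIndependent_iff']
  intro s g hg i hi
  set x : ℂ → V := fun z => ∑ k ∈ s with ν k = z, g k • v k with hx
  have hxe : ∀ z, x z ∈ S.eigenspace z := by
    intro z
    refine Submodule.sum_mem _ fun k hk => Submodule.smul_mem _ _ ?_
    rw [Module.End.mem_eigenspace_iff, hv, (Finset.mem_filter.1 hk).2]
  have hsum : ∑ z ∈ s.image ν, x z = 0 := by
    rw [← hg]
    exact Finset.sum_fiberwise_of_maps_to (fun k hk => Finset.mem_image_of_mem ν hk) _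
  have hxi : x (ν i) = 0 := by
    have hind := S.eigenspaces_iSupIndep
    by_contra hne
    have hmem : x (ν i) ∈ ⨆ z, ⨆ (_ : z ≠ ν i), S.eigenspace z := by
      have e : x (ν i) = -∑ z ∈ (s.image ν).erase (ν i), x z := by
        rw [eq_neg_iff_add_eq_zero, Finset.add_sum_erase _ _ (Finset.mem_image_of_mem ν hi), hsum]
      rw [e]
      refine Submodule.neg_mem _ (Submodule.sum_mem _ fun z hz => ?_)
      exact Submodule.mem_iSup_of_mem z
        (Submodule.mem_iSup_of_mem (Finset.ne_of_mem_erase hz) (hxe z))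
    exact hne ((Submodule.disjoint_def.1 (hind (ν i))) _ (hxe _) hmem)
  by_cases hj : ∃ j ∈ s, j ≠ i ∧ ν j = ν i
  · obtain ⟨j, hjs, hji, hjν⟩ := hj
    have hfil : s.filter (fun k => ν k = ν i) = {i, j} := by
      ext k
      simp only [Finset.mem_filter, Finset.mem_insert, Finset.mem_singleton]
      constructor
      · rintro ⟨_, hk⟩
        rcases h3 k i j hk hjν.symm with h | h | h
        · exact Or.inl h
        · exact absurd h.symm hji
        · exact Or.inr h
      · rintro (rfl | rfl)
        · exact ⟨hi, rfl⟩
        · exact ⟨hjs, hjν⟩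
    have hxi' : g i • v i + g j • v j = 0 := by
      rw [← hxi, hx]
      dsimp only
      rw [hfil, Finset.sum_pair hji.symm]
    by_contra hgi
    refine h2 i j hji.symm hjν.symm (-(g i)⁻¹ * g j) ?_
    have h5 : g i • v i = -(g j • v j) := eq_neg_of_add_eq_zero_left hxi'
    rw [mul_smul, neg_smul, ← smul_neg, ← h5, inv_smul_smul₀ hgi]
  · have hfil : s.filter (fun k => ν k = ν i) = {i} := by
      ext k
      simp only [Finset.mem_filter, Finset.mem_singleton]
      constructor
      · rintro ⟨hk, hkν⟩
        by_contra hne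
        exact hj ⟨k, hk, hne, hkν⟩
      · rintro rfl
        exact ⟨hi, rfl⟩
    have hxi' : g i • v i = 0 := by
      rw [← hxi, hx]
      dsimp only
      rw [hfil, Finset.sum_singleton]
    exact (smul_eq_zero.1 hxi').resolve_right (h0 i)

theorem IsBloch.ne_zero {T : ℕ} {a b : ℕ → ℝ} {l : ℝ} {μ : ℂ} {ψ : ℕ → ℂ}
    (h : IsBloch T a b l μ ψ) (n : ℕ) : ψ n ≠ 0 := fun h0 => by
  have := h.wronskian n
  rw [h0] at this
  simp at this

theorem IsBloch.normSq_mult {T : ℕ} {a b : ℕ → ℝ} {l : ℝ} {μ : ℂ} {ψ : ℕ → ℂ}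
    (h : IsBloch T a b l μ ψ) : μ.re ^ 2 + μ.im ^ 2 = 1 := by
  have h1 := Complex.normSq_eq_norm_sq μ
  rw [h.norm_mult, Complex.normSq_apply] at h1
  linarith

/-- The shift by T has the resonance functions as eigenvectors, with multipliers 1, μ² and conj(μ)².
Since μ² is not real, multipliers coincide only between different eigenvalues, at most two at a
time, and `eq_or_forall_of_sq_eq` then excludes proportionality. -/
theorem linearIndependent_resonance {ι : Type*} {T : ℕ} {a b : ℕ → ℝ}
    (hbT : Function.Periodic b T) (hT : 0 < T) {lam : ι → ℝ}
    {μ : ι → ℂ} {ψ : ι → ℕ → ℂ} (hψ : ∀ r, IsBloch T a b (lam r) (μ r) (ψ r))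
    (hre : ∀ r, (μ r).re ≠ 0) (him : ∀ r, (μ r).im ≠ 0)
    (hsym : ∀ r s, r ≠ s → lam r ≠ lam s ∧ ¬ ∀ n, 2 * b (n + 1) = lam r + lam s)
    (hthree : ∀ r s t, (μ r).re ^ 2 = (μ s).re ^ 2 → (μ s).re ^ 2 = (μ t).re ^ 2 →
      r = s ∨ s = t ∨ r = t) (r₀ : ι) :
    LinearIndependent ℂ (resonance (fun r m => ψ r (m + 1)) r₀) := by
  -- the multipliers of the squared Bloch solutions
  have hre2 : ∀ r, (μ r ^ 2).re = 2 * (μ r).re ^ 2 - 1 := fun r => by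
    have := (hψ r).normSq_mult
    rw [sq, Complex.mul_re]
    linarith
  have him2 : ∀ r, (μ r ^ 2).im ≠ 0 := fun r => by
    rw [sq, Complex.mul_im]
    have := mul_ne_zero (hre r) (him r)
    intro h
    exact this (by linarith)
  let ν : Option (ι × Bool) → ℂ := fun o =>
    match o with
    | none => 1
    | some (r, true) => μ r ^ 2
    | some (r, false) => conj (μ r) ^ 2
  have hνre : ∀ r σ, (ν (some (r, σ))).re = 2 * (μ r).re ^ 2 - 1 := by
    rintro r (σ | σ)
    · change (conj (μ r) ^ 2).re = _
      rw [← map_pow, Complex.conj_re, hre2]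
    · exact hre2 r
  have hνim : ∀ r σ, (ν (some (r, σ))).im = if σ then (μ r ^ 2).im else -(μ r ^ 2).im := by
    rintro r (σ | σ)
    · change (conj (μ r) ^ 2).im = _
      rw [← map_pow, Complex.conj_im]; simp
    · change (μ r ^ 2).im = _
      simp
  have hν1 : ∀ r σ, ν (some (r, σ)) ≠ 1 := by
    intro r σ h
    have h1 := hνim r σ
    rw [h, Complex.one_im] at h1
    have := him2 r
    split_ifs at h1
    · exact this h1.symm
    · exact this (by linarith)
  have hνsame : ∀ r σ τ, ν (some (r, σ)) = ν (some (r, τ)) → σ = τ := by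
    intro r σ τ h
    have h1 := congrArg Complex.im h
    rw [hνim, hνim] at h1
    have := him2 r
    rcases σ <;> rcases τ
    · rfl
    · simp only [Bool.false_eq_true, if_false, if_true] at h1
      exact absurd (by linarith) this
    · simp only [Bool.false_eq_true, if_false, if_true] at h1
      exact absurd (by linarith) this
    · rfl
  have hνsq : ∀ r σ s τ, ν (some (r, σ)) = ν (some (s, τ)) → (μ r).re ^ 2 = (μ s).re ^ 2 := by
    intro r σ s τ h
    have h1 := congrArg Complex.re h
    rw [hνre, hνre] at h1
    linarith
  -- both signs are solutions
  have hsol : ∀ r (σ : Bool), ∃ (φ : ℕ → ℂ) (w : ℝ), w ≠ 0 ∧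
      (∀ n, a (n + 1) * φ n + b (n + 1 + 1) * φ (n + 1) + a (n + 1 + 1) * φ (n + 2) =
        lam r * φ (n + 1)) ∧ (∀ n, a (n + 1) * (conj (φ n) * φ (n + 1)).im = w) ∧
      resonance (fun r m => ψ r (m + 1)) r₀ (some (r, σ)) = fun m => φ m ^ 2 := by
    rintro r (σ | σ)
    · refine ⟨fun n => conj (ψ r (n + 1)), -1, by norm_num, fun n => ?_, fun n => ?_, rfl⟩
      · have := congrArg conj ((hψ r).equation (n + 1))
        simpa using this
      · have := (hψ r).wronskian (n + 1)
        rw [← map_mul, Complex.conj_im]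
        linarith
    · exact ⟨fun n => ψ r (n + 1), 1, one_ne_zero, fun n => (hψ r).equation (n + 1),
        fun n => (hψ r).wronskian (n + 1), rfl⟩
  let S : Module.End ℂ (ℕ → ℂ) := LinearMap.funLeft ℂ ℂ fun m => m + T
  have hne : ∀ o, resonance (fun r m => ψ r (m + 1)) r₀ o ≠ 0 := by
    intro o h
    have h1 := congrFun h 0
    have hψ0 : ∀ r, ψ r (0 + 1) ≠ 0 := fun r => (hψ r).ne_zero _
    rcases o with _ | ⟨r, _ | _⟩ <;> simp [resonance] at h1
    · exact hψ0 _ h1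
    · exact hψ0 _ h1
    · exact hψ0 _ h1
  have hshift : ∀ r m, ψ r (m + T + 1) = μ r * ψ r (m + 1) := fun r m => by
    rw [← (hψ r).quasiperiodic]; congr 1; ring
  refine linearIndependent_of_eigenvectors S (ν := ν) ?_ hne ?_ ?_
  · intro o
    ext m
    rw [LinearMap.funLeft_apply, Pi.smul_apply, smul_eq_mul]
    rcases o with _ | ⟨r, _ | _⟩
    · simp only [resonance, ν, hshift, norm_mul, (hψ r₀).norm_mult, one_mul]
    · simp only [resonance, ν, hshift, map_mul]; ring
    · simp only [resonance, ν, hshift]; ring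
  · intro k l hkl hν c hc
    rcases k with _ | ⟨r, σ⟩ <;> rcases l with _ | ⟨s, τ⟩
    · exact hkl rfl
    · exact hν1 s τ hν.symm
    · exact hν1 r σ hν
    · by_cases hrs : r = s
      · subst hrs
        exact hkl (by rw [hνsame r σ τ hν])
      · obtain ⟨φ, w, hw, h1, h2, h3⟩ := hsol r σ
        obtain ⟨χ, w', hw', h1', h2', h3'⟩ := hsol s τ
        rw [h3, h3'] at hc
        rcases eq_or_forall_of_sq_eq (a := fun n => a (n + 1)) (b := fun n => b (n + 1))
          h1 h1' hw h2 h2' (fun n => congrFun hc n) with h | h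
        · exact (hsym r s hrs).1 h
        · refine (hsym r s hrs).2 fun n => ?_
          -- Here `h` concerns the shifted diagonal, b 2 onwards; b 1 is reached by periodicity, as
          -- T > 0.
          rw [← h (n + T - 1), ← hbT (n + 1)]
          congr 2
          omega
  · intro k l m hkl hlm
    rcases k with _ | ⟨r, σ⟩ <;> rcases l with _ | ⟨s, τ⟩ <;> rcases m with _ | ⟨t, υ⟩
    · exact Or.inl rfl
    · exact Or.inl rfl
    · exact Or.inr (Or.inr rfl)
    · exact absurd hkl.symm (hν1 s τ)
    · exact Or.inr (Or.inl rfl)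
    · exact absurd hkl (hν1 r σ)
    · exact absurd hlm (hν1 s τ)
    · rcases hthree r s t (hνsq _ _ _ _ hkl) (hνsq _ _ _ _ hlm) with h | h | h
      · subst h; exact Or.inl (by rw [hνsame _ _ _ hkl])
      · subst h; exact Or.inr (Or.inl (by rw [hνsame _ _ _ hlm]))
      · subst h; exact Or.inr (Or.inr (by rw [hνsame _ _ _ (hkl.trans hlm)]))

/-! ### From decaying coordinates to eigenvectors. -/

/-- The solution of the perturbed equation that satisfies the boundary condition, in terms of its
Wronskian coordinate. -/
noncomputable def perturbedSol (ψ : ℕ → ℂ) (ρ : ℕ → ℝ) (z : ℂ) (m : ℕ) : ℝ :=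
  -(evo (fun k => ψ (k + 1)) ρ z m * ψ (m + 1)).im

theorem evo_eq_perturbedSol (ψ : ℕ → ℂ) (ρ : ℕ → ℝ) (z : ℂ) (m : ℕ) : evo (fun k => ψ (k + 1)) ρ z (m + 1) =
    evo (fun k => ψ (k + 1)) ρ z m + (ρ m * perturbedSol ψ ρ z m : ℝ) * conj (ψ (m + 1)) := by
  rw [evo_succ, perturbedSol]
  push_cast
  ring

/-- The update adds a real multiple of conj φ, and conj(φ) φ is real, so z_m and z_{m+1} give the
same value at this site. -/
theorem perturbedSol_eq (ψ : ℕ → ℂ) (ρ : ℕ → ℝ) (z : ℂ) (m : ℕ) :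
    perturbedSol ψ ρ z m = -(evo (fun k => ψ (k + 1)) ρ z (m + 1) * ψ (m + 1)).im := by
  rw [evo_eq_perturbedSol, add_mul, Complex.add_im, mul_assoc, mul_comm (conj _), Complex.mul_conj,
    ← Complex.ofReal_mul, Complex.ofReal_im, add_zero, perturbedSol]

/-- With z_m frozen, -Im (z_m ψ) solves the unperturbed equation. The update to z_{m+1} alters only
the last term, by exactly the potential term, since the Wronskian is 1. -/
theorem IsBloch.perturbedSol_equation {T : ℕ} {a b : ℕ → ℝ} {l : ℝ} {μ : ℂ} {ψ : ℕ → ℂ}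
    (h : IsBloch T a b l μ ψ) (ρ : ℕ → ℝ) (z : ℂ) (m : ℕ) :
    a m * -(evo (fun k => ψ (k + 1)) ρ z m * ψ m).im +
      (b (m + 1) + ρ m) * perturbedSol ψ ρ z m + a (m + 1) * perturbedSol ψ ρ z (m + 1) =
      l * perturbedSol ψ ρ z m := by
  have h1 := h.wronskian (m + 1)
  have h2 : perturbedSol ψ ρ z (m + 1) = -(evo (fun k => ψ (k + 1)) ρ z m * ψ (m + 2)).im -
      ρ m * perturbedSol ψ ρ z m * (conj (ψ (m + 1)) * ψ (m + 2)).im := by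
    rw [perturbedSol, evo_eq_perturbedSol, add_mul, Complex.add_im, mul_assoc (Complex.ofReal _),
      Complex.im_ofReal_mul, neg_add, ← sub_eq_add_neg]
  have h3 : a m * (evo (fun k => ψ (k + 1)) ρ z m * ψ m).im +
      a (m + 1) * (evo (fun k => ψ (k + 1)) ρ z m * ψ (m + 2)).im =
      (l - b (m + 1)) * (evo (fun k => ψ (k + 1)) ρ z m * ψ (m + 1)).im := by
    rw [← Complex.im_ofReal_mul, ← Complex.im_ofReal_mul, ← Complex.im_ofReal_mul,
      ← Complex.add_im]
    congr 1
    push_cast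
    linear_combination (evo (fun k => ψ (k + 1)) ρ z m) * h.equation m
  rw [h2]
  have h4 : perturbedSol ψ ρ z m = -(evo (fun k => ψ (k + 1)) ρ z m * ψ (m + 1)).im := rfl
  linear_combination (-1 : ℝ) * h3 - ρ m * perturbedSol ψ ρ z m * h1 + (b (m + 1) - l) * h4

/-- The boundary value of the Wronskian coordinate. -/
noncomputable def boundaryValue (a : ℕ → ℝ) (ψ : ℕ → ℂ) : ℂ := -(a 0 * conj (ψ 0))

theorem IsBloch.boundaryValue_ne_zero {T : ℕ} {a b : ℕ → ℝ} {l : ℝ} {μ : ℂ} {ψ : ℕ → ℂ}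
    (h : IsBloch T a b l μ ψ) (ha : 0 < a 0) : boundaryValue a ψ ≠ 0 := by
  have := h.ne_zero 0
  simp [boundaryValue, ha.ne', this]

/-- The eigenvalue equation for a sequence indexed from zero, together with the boundary condition,
the normalisation and the decay that make it an eigenvector. -/
structure IsDecayingSol (a b : ℕ → ℝ) (ρ : ℕ → ℝ) (l : ℝ) (U : ℕ → ℝ) : Prop where
  zero : U 0 = 1
  first : (b 1 + ρ 0) * U 0 + a 1 * U 1 = l * U 0
  next : ∀ m, a (m + 1) * U m + (b (m + 2) + ρ (m + 1)) * U (m + 1) + a (m + 2) * U (m + 2) =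
    l * U (m + 1)
  decay : ∃ C, ∀ m : ℕ, |U m| ≤ C / (m + 1)

theorem IsBloch.isDecayingSol {T : ℕ} {a b : ℕ → ℝ} {l : ℝ} {μ : ℂ} {ψ : ℕ → ℂ}
    (h : IsBloch T a b l μ ψ) (hT : 0 < T) {ρ : ℕ → ℝ}
    (hdec : ∃ C, ∀ m : ℕ,
      ‖evo (fun k => ψ (k + 1)) ρ (boundaryValue a ψ) m‖ ≤ C / (m + 1)) :
    IsDecayingSol a b ρ l (perturbedSol ψ ρ (boundaryValue a ψ)) where
  zero := by
    have h1 := h.wronskian 0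
    rw [perturbedSol, evo_zero, boundaryValue, neg_mul, mul_assoc, Complex.neg_im, neg_neg,
      Complex.im_ofReal_mul]
    exact h1
  first := by
    have h1 := h.perturbedSol_equation ρ (boundaryValue a ψ) 0
    -- The Dirichlet condition at the site before the first.
    have h2 : (boundaryValue a ψ * ψ 0).im = 0 := by
      rw [boundaryValue, neg_mul, mul_assoc, mul_comm (conj _), Complex.mul_conj,
        ← Complex.ofReal_mul, ← Complex.ofReal_neg, Complex.ofReal_im]
    rw [evo_zero, h2] at h1
    simpa using h1
  next m := by
    have h1 := h.perturbedSol_equation ρ (boundaryValue a ψ) (m + 1)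
    rwa [← perturbedSol_eq] at h1
  decay := by
    obtain ⟨C, hC⟩ := hdec
    obtain ⟨B, hB⟩ := exists_norm_le_of_quasiperiodic h.norm_mult hT h.quasiperiodic
    refine ⟨C * B, fun m => ?_⟩
    rw [perturbedSol, abs_neg]
    refine (Complex.abs_im_le_norm _).trans ?_
    rw [norm_mul, mul_div_right_comm]
    exact mul_le_mul (hC m) (hB _) (norm_nonneg _) ((norm_nonneg _).trans (hC m))

/-- For a constant diagonal, reflecting the perturbation reflects the eigenvalue. -/
theorem IsDecayingSol.alternate {a b ρ : ℕ → ℝ} {l l' : ℝ} {U : ℕ → ℝ}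
    (h : IsDecayingSol a b (-ρ) l U) (hb : ∀ n, 2 * b (n + 1) = l + l') :
    IsDecayingSol a b ρ l' fun m => (-1) ^ m * U m where
  zero := by simp [h.zero]
  first := by
    have h1 := h.first
    have h2 := hb 0
    rw [zero_add] at h2
    simp only [Pi.neg_apply] at h1
    linear_combination (-1 : ℝ) * h1 + U 0 * h2
  next m := by
    have h1 := h.next m
    have h2 := hb (m + 1)
    simp only [Pi.neg_apply] at h1
    rw [pow_succ, pow_succ]
    linear_combination (-1) ^ m * (h1 - U (m + 1) * h2)
  decay := by
    obtain ⟨C, hC⟩ := h.decay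
    refine ⟨C, fun m => ?_⟩
    rw [abs_mul, abs_pow, abs_neg, abs_one, one_pow, one_mul]
    exact hC m

theorem IsDecayingSol.exists_eigenvector {a b ρ : ℕ → ℝ} {l : ℝ} {U : ℕ → ℝ}
    (h : IsDecayingSol a b ρ l U) :
    ∃ u : lp (fun _ : ℕ+ => ℝ) 2, u ≠ 0 ∧
      act (jacobiMatrix a b + Matrix.diagonal fun n : ℕ+ => ρ n.natPred) (⇑u) =
        l • (⇑u : ℕ+ → ℝ) := by
  have hmem : Memℓp (fun n : ℕ+ => U n.natPred) 2 := by
    obtain ⟨C, hC⟩ := h.decay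
    refine memℓp_gen ?_
    have hsum : Summable fun m : ℕ => C ^ 2 * (1 / ((m : ℝ) + 1) ^ 2) := by
      refine Summable.mul_left _ ?_
      have := (summable_nat_add_iff 1).2 (Real.summable_one_div_nat_pow.2 one_lt_two)
      simpa using this
    have hU : Summable fun m : ℕ => ‖U m‖ ^ (ENNReal.toReal 2) := by
      refine Summable.of_nonneg_of_le (fun m => by positivity) (fun m => ?_) hsum
      rw [ENNReal.toReal_ofNat, Real.rpow_ofNat, Real.norm_eq_abs]
      calc |U m| ^ 2 ≤ (C / (m + 1)) ^ 2 := by gcongr; exact hC m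
        _ = _ := by rw [div_pow]; ring
    exact hU.comp_injective PNat.natPred_injective
  refine ⟨⟨fun n : ℕ+ => U n.natPred, hmem⟩, fun h0 => ?_, ?_⟩
  · have h1 := congrArg (fun u : lp (fun _ : ℕ+ => ℝ) 2 => (u : ℕ+ → ℝ) 1) h0
    have h2 : U 0 = 0 := h1
    rw [h.zero] at h2
    exact one_ne_zero h2
  · change act _ (fun n : ℕ+ => U n.natPred) = l • fun n : ℕ+ => U n.natPred
    ext n
    have hpred : ∀ m : ℕ+, (m + 1).natPred = m.natPred + 1 := fun m => by
      have := m.natPred_add_one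
      have := (m + 1).natPred_add_one
      rw [PNat.add_coe, PNat.one_coe] at this
      omega
    rw [Pi.smul_apply, smul_eq_mul]
    induction n using PNat.recOn with
    | one =>
      rw [act_jacobi_one, hpred]
      exact h.first
    | succ m _ =>
      rw [act_jacobi_succ, hpred (m + 1), hpred m]
      have h1 := h.next m.natPred
      have h2 := m.natPred_add_one
      have h3 : ((m + 1 : ℕ+) : ℕ) = m.natPred + 2 := by
        rw [PNat.add_coe, PNat.one_coe]; omega
      rw [h3, ← h2]
      exact h1

/-! ### Arithmetic of the quasi-momenta and assembly. -/

/-- The indices j and k may coincide, which covers two-term relations. -/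
theorem eq_zero_of_add_add_eq_zero {κ : Type*} {v : κ → ℝ} (hv : LinearIndependent ℚ v)
    {i j k : κ} (hij : i ≠ j) (hik : i ≠ k) {x y z : ℚ}
    (h : (x : ℝ) * v i + y * v j + z * v k = 0) : x = 0 := by
  have h1 := linearIndependent_iff.1 hv
    (Finsupp.single i x + Finsupp.single j y + Finsupp.single k z) (by
      simpa [Rat.smul_def] using h)
  have h2 := DFunLike.congr_fun h1 i
  simpa [hij, hik, hij.symm, hik.symm] using h2

/-- Embedding of eigenvalues, when no three quasi-momenta agree up to reflection. -/
theorem exists_embedding {T : ℕ} (hT : 0 < T) {a b : ℕ → ℝ} (ha : ∀ i, 0 < a i)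
    (haT : Function.Periodic a T) (hbT : Function.Periodic b T) {lam : ℕ+ → ℝ}
    (hlam : ∀ i, lam i ∈ sigmaEll T a b)
    (hhalf : ∀ i, quasiMomentum T a b (lam i) ≠ Real.pi / 2)
    (hthree : ∀ i j k, Real.cos (quasiMomentum T a b (lam i)) ^ 2 =
        Real.cos (quasiMomentum T a b (lam j)) ^ 2 →
      Real.cos (quasiMomentum T a b (lam j)) ^ 2 = Real.cos (quasiMomentum T a b (lam k)) ^ 2 →
      i = j ∨ j = k ∨ i = k)
    {κ : ℕ → ℝ} (hκ0 : ∀ m, 0 < κ m) (hκ : Tendsto κ atTop atTop) :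
    ∃ ρ : ℕ → ℝ, (∀ m : ℕ, |ρ m| ≤ κ m / (m + 1)) ∧
      ∀ i, ∃ U, IsDecayingSol a b ρ (lam i) U := by
  choose μ ψ hψ using fun i => exists_isBloch ha haT hbT (hlam i)
  have hcos : ∀ i, Real.cos (quasiMomentum T a b (lam i)) ≠ 0 := by
    intro i h
    have h1 := quasiMomentum_mem (hlam i)
    refine hhalf i (Real.injOn_cos ⟨h1.1.le, h1.2.le⟩ ⟨by positivity, ?_⟩ ?_)
    · linarith [Real.pi_pos]
    · rw [h, Real.cos_pi_div_two]
  have him : ∀ i, (μ i).im ≠ 0 := by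
    intro i h
    have h1 := quasiMomentum_mem (hlam i)
    have h2 := (hψ i).normSq_mult
    rw [h, (hψ i).re_mult] at h2
    have h3 := Real.sin_pos_of_pos_of_lt_pi h1.1 h1.2
    have h4 := Real.sin_sq_add_cos_sq (quasiMomentum T a b (lam i))
    nlinarith
  -- two eigenvalues that are equal, or exchanged by a symmetry, are treated together
  obtain ⟨R, hR⟩ : ∃ R : ℕ+ → ℕ+ → Prop, ∀ i j, R i j ↔
      (lam i = lam j ∨ ∀ n, 2 * b (n + 1) = lam i + lam j) := ⟨_, fun _ _ => Iff.rfl⟩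
  have hsymm : ∀ i j, R i j → R j i := by
    intro i j
    rw [hR, hR]
    rintro (h | h)
    · exact Or.inl h.symm
    · exact Or.inr fun n => by rw [h n, add_comm]
  have htrans : ∀ i j k, R i j → R j k → R i k := by
    intro i j k
    rw [hR, hR, hR]
    rintro (h | h) (h' | h')
    · exact Or.inl (h.trans h')
    · exact Or.inr fun n => by rw [h' n, h]
    · exact Or.inr fun n => by rw [h n, h']
    · exact Or.inl (by linarith [h 0, h' 0])
  -- The least index of each class serves as its representative.
  have hrep : ∀ i, ∃ r, (∀ j < r, ¬ R r j) ∧ R i r := by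
    intro i
    induction i using PNat.strongInductionOn with
    | _ i ih =>
      by_cases hi : ∃ j < i, R i j
      · obtain ⟨j, hj, hij⟩ := hi
        obtain ⟨r, hr, hjr⟩ := ih j hj
        exact ⟨r, hr, htrans _ _ _ hij hjr⟩
      · push Not at hi
        exact ⟨i, hi, (hR i i).2 (Or.inl rfl)⟩
  let ι := {r : ℕ+ // ∀ j < r, ¬ R r j}
  have hsep : ∀ r s : ι, r ≠ s → ¬ R r s := by
    intro r s hrs h
    rcases lt_trichotomy (r : ℕ+) s with h1 | h1 | h1
    · exact s.2 r h1 (hsymm _ _ h)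
    · exact hrs (Subtype.ext h1)
    · exact r.2 s h1 h
  have hind := linearIndependent_resonance (ι := ι) hbT hT (fun r => hψ r)
    (fun r => by rw [(hψ r).re_mult]; exact hcos r) (fun r => him r)
    (fun r s hrs => not_or.1 ((hR r s).not.1 (hsep r s hrs))) (by
      intro r s t
      rw [(hψ r).re_mult, (hψ s).re_mult, (hψ t).re_mult, Subtype.ext_iff, Subtype.ext_iff,
        Subtype.ext_iff]
      exact hthree r s t)
  have hbv : ∀ r : ι, boundaryValue a (ψ r) ≠ 0 := fun r => (hψ r).boundaryValue_ne_zero (ha 0)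
  obtain ⟨ρ, hρ, hdec⟩ := exists_decaying (fun (r : ι) m => ψ r (m + 1)) hind hT
    (fun r => (hψ r).norm_mult) (fun r m => by
      rw [← (hψ r).quasiperiodic]; congr 1; ring) hbv hbv hκ0 hκ
  refine ⟨ρ, hρ, fun i => ?_⟩
  obtain ⟨r, hr, hir⟩ := hrep i
  obtain ⟨hplus, hminus⟩ := hdec ⟨r, hr⟩
  rcases (hR i r).1 hir with h | h
  · rw [h]
    exact ⟨_, (hψ r).isDecayingSol hT hplus⟩
  -- A reflected eigenvalue uses the state driven by -ρ.
  · exact ⟨_, ((hψ r).isDecayingSol hT hminus).alternate fun n => by rw [h n, add_comm]⟩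

end PeriodicJacobi

theorem theorem4p3 (T : ℕ) (hT : 0 < T) (a b : ℕ → ℝ) (ha : ∀ i, 0 < a i)
    (haT : Function.Periodic a T) (hbT : Function.Periodic b T)
    (lam : ℕ+ → ℝ) (hlam : ∀ i, lam i ∈ PeriodicJacobi.sigmaEll T a b)
    (hind : ∀ n : ℕ+, 3 ≤ n → LinearIndependent ℚ (fun o : Option (Set.Icc (3 : ℕ+) n) =>
      o.elim Real.pi fun i => PeriodicJacobi.quasiMomentum T a b (lam i)))
    (h1 : 0 < PeriodicJacobi.quasiMomentum T a b (lam 1))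
    (h1' : PeriodicJacobi.quasiMomentum T a b (lam 1) < Real.pi / 2)
    (h2 : Real.pi / 2 < PeriodicJacobi.quasiMomentum T a b (lam 2))
    (h2' : PeriodicJacobi.quasiMomentum T a b (lam 2) < Real.pi)
    (h12 : PeriodicJacobi.quasiMomentum T a b (lam 1) ≠
      Real.pi - PeriodicJacobi.quasiMomentum T a b (lam 2))
    (K : ℕ+ → ℝ) (hKpos : ∀ n, 0 < K n) (hK : Tendsto K atTop atTop) :
    ∃ q : ℕ+ → ℝ, Tendsto q atTop (𝓝 0) ∧ (∀ n : ℕ+, |q n| ≤ K n / (n : ℝ)) ∧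
      ∀ i : ℕ+, ∃ u : lp (fun _ : ℕ+ => ℝ) 2, u ≠ 0 ∧
        PeriodicJacobi.act (PeriodicJacobi.jacobiMatrix a b + Matrix.diagonal q) (⇑u) =
          lam i • (⇑u : ℕ+ → ℝ) := by
  set θ : ℕ+ → ℝ := fun i => PeriodicJacobi.quasiMomentum T a b (lam i) with hθ
  have hmem : ∀ i, θ i ∈ Set.Ioo 0 Real.pi := fun i => PeriodicJacobi.quasiMomentum_mem (hlam i)
  have hlt3 : ∀ i : ℕ+, i < 3 → i = 1 ∨ i = 2 := by
    intro i hi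
    have h3 : (i : ℕ) < 3 := hi
    have h4 := i.pos
    rcases (by omega : (i : ℕ) = 1 ∨ (i : ℕ) = 2) with h | h
    · exact Or.inl (PNat.eq h)
    · exact Or.inr (PNat.eq h)
  have hhalf : ∀ i, θ i ≠ Real.pi / 2 := by
    intro i hi
    rcases lt_or_ge i 3 with h3 | h3
    · rcases hlt3 i h3 with rfl | rfl
      · exact h1'.ne hi
      · exact h2.ne' hi
    · have := PeriodicJacobi.eq_zero_of_add_add_eq_zero (hind i h3)
        (i := some ⟨i, h3, le_rfl⟩) (j := none) (k := none) (x := 2) (y := -1) (z := 0)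
        (by simp) (by simp) (by
          change ((2 : ℚ) : ℝ) * θ i + ((-1 : ℚ) : ℝ) * Real.pi + ((0 : ℚ) : ℝ) * Real.pi = 0
          rw [hi]; push_cast; ring)
      norm_num at this
  have hpair : ∀ i j, 3 ≤ i → 3 ≤ j → i ≠ j → θ i ≠ θ j ∧ θ i + θ j ≠ Real.pi := by
    intro i j hi hj hij
    have key : ∀ y z : ℚ, ((1 : ℚ) : ℝ) * θ i + (y : ℝ) * θ j + (z : ℝ) * Real.pi ≠ 0 := by
      intro y z h
      refine one_ne_zero (PeriodicJacobi.eq_zero_of_add_add_eq_zero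
        (hind (max i j) (hi.trans (le_max_left i j)))
        (i := some ⟨i, hi, le_max_left i j⟩) (j := some ⟨j, hj, le_max_right i j⟩) (k := none)
        (x := 1) (y := y) (z := z) (fun e => hij (congrArg Subtype.val (Option.some.inj e))) (by simp) h)
    constructor
    · intro h
      exact key (-1) 0 (by rw [h]; push_cast; ring)
    · intro h
      refine key 1 (-1) ?_
      push_cast
      linarith
  have hcol : ∀ i j, Real.cos (θ i) ^ 2 = Real.cos (θ j) ^ 2 → θ i = θ j ∨ θ i + θ j = Real.pi := by
    intro i j h
    have hi := hmem i
    have hj := hmem j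
    rcases sq_eq_sq_iff_eq_or_eq_neg.1 h with h | h
    · exact Or.inl (Real.injOn_cos ⟨hi.1.le, hi.2.le⟩ ⟨hj.1.le, hj.2.le⟩ h)
    · right
      rw [← Real.cos_pi_sub] at h
      have := Real.injOn_cos ⟨hi.1.le, hi.2.le⟩ ⟨by linarith [hj.2], by linarith [hj.1]⟩ h
      linarith
  -- Equal cos² can only link an index below 3 with one from 3 on; of three distinct indices two lie
  -- on the same side, so no three agree.
  have hside : ∀ i j, i ≠ j → Real.cos (θ i) ^ 2 = Real.cos (θ j) ^ 2 → (i < 3 ↔ ¬ j < 3) := by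
    intro i j hij h
    rcases lt_or_ge i 3 with hi | hi <;> rcases lt_or_ge j 3 with hj | hj
    · exfalso
      rcases hlt3 i hi with rfl | rfl <;> rcases hlt3 j hj with rfl | rfl
      · exact hij rfl
      · rcases hcol _ _ h with h | h
        · exact (h1'.trans h2).ne h
        · exact h12 (eq_sub_of_add_eq h)
      · rcases hcol _ _ h with h | h
        · exact (h1'.trans h2).ne' h
        · exact h12 (eq_sub_of_add_eq' h)
      · exact hij rfl
    · simp [hi, hj]
    · simp [hi, hj]
    · exfalso
      rcases hcol _ _ h with h | h
      · exact (hpair i j hi hj hij).1 h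
      · exact (hpair i j hi hj hij).2 h
  have hK' : Tendsto (fun m : ℕ => K m.succPNat) atTop atTop :=
    hK.comp (tendsto_atTop.2 fun n => by
      filter_upwards [eventually_ge_atTop (n : ℕ)] with m hm
      exact hm.trans (Nat.le_succ m))
  have hsqrt : Tendsto (fun m : ℕ => √((m : ℝ) + 1)) atTop atTop :=
    Real.tendsto_sqrt_atTop.comp
      (tendsto_atTop_add_const_right _ _ tendsto_natCast_atTop_atTop)
  obtain ⟨ρ, hρ, hU⟩ := PeriodicJacobi.exists_embedding hT ha haT hbT hlam hhalf (by
      intro i j k hij hjk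
      by_contra! hne
      have e1 := hside i j hne.1 hij
      have e2 := hside j k hne.2.1 hjk
      have e3 := hside i k hne.2.2 (hij.trans hjk)
      tauto)
    -- The square root forces q → 0 even when K(n)/n does not tend to 0.
    (κ := fun m => min (K m.succPNat) √((m : ℝ) + 1))
    (fun m => lt_min (hKpos _) (Real.sqrt_pos.2 (by positivity)))
    (tendsto_atTop.2 fun B => by
      filter_upwards [hK'.eventually_ge_atTop B, hsqrt.eventually_ge_atTop B] with m x y
      exact le_min x y)
  have hnat : ∀ n : ℕ+, (n.natPred : ℝ) + 1 = n := fun n => by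
    exact_mod_cast n.natPred_add_one
  refine ⟨fun n => ρ n.natPred, ?_, fun n => ?_, fun i => ?_⟩
  · have h0 : Tendsto ρ atTop (𝓝 0) := by
      refine squeeze_zero_norm (fun m => ?_) (tendsto_inv_atTop_zero.comp hsqrt)
      have hm : (0 : ℝ) < (m : ℝ) + 1 := by positivity
      calc ‖ρ m‖ ≤ √((m : ℝ) + 1) / (m + 1) :=
            (hρ m).trans (by gcongr; exact min_le_right _ _)
        _ = _ := by rw [Real.sqrt_div_self', one_div]; rfl
    refine h0.comp (tendsto_atTop.2 fun m => ?_)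
    filter_upwards [eventually_ge_atTop m.succPNat] with n hn
    have h3 : m + 1 ≤ n := hn
    have h4 := n.natPred_add_one
    omega
  · refine (hρ _).trans ?_
    rw [hnat, PNat.succPNat_natPred]
    gcongr
    exact min_le_left _ _
  · obtain ⟨U, hU⟩ := hU i
    exact hU.exists_eigenvector
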